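/- Let $V\colon\mathbb R^4\to\mathbb R$ be such that $\langle\log|x|\rangle^2\langle x\rangle^3V\in L^1(\mathbb R^4)\cap L^q(\mathbb R^4)$ for some $q>1$, where $\langle y\rangle=(1+|y|^2)^{1/2}$. Let $H=\Delta^2+V$ and let $$\mathcal N_\infty(H)=\{u\in L^\infty(\mathbb R^4):\ (\Delta^2+V)u=0\}$$ be the space of (complex-valued) essentially bounded functions $u$ that satisfy the equation in the sense of distributions, i.e. $\int_{\mathbb R^4}u\,(\Delta^2f+Vf)\,dx=0$ for all $f\in C_c^\infty(\mathbb R^4)$. Then $\mathcal N_\infty(H)$ is a finite-dimensional real vector space. Moreover, for every real-valued $\varphi\in\mathcal N_\infty(H)$ there exist $c_0\in\mathbb R$, $\mathbf a\in\mathbb R^4$ and a real symmetric $4\times4$ matrix $A$ such that $$\varphi(x)=-c_0+\frac{\mathbf a\cdot x}{|x|^2}+\frac{Ax\cdot x}{|x|^4}+O(|x|^{-3})\qquad(|x|\to\infty),$$ that is, for some $C,R>0$ the difference of $\varphi(x)$ and the first three terms is at most $C|x|^{-3}$ in absolute value for almost every $x$ with $|x|\ge R$. -/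

import Mathlib

open MeasureTheory Filter Asymptotics Laplacian
open scoped ENNReal ContDiff Matrix

/-- The space `ℝ⁴` with its Euclidean norm. -/
abbrev R4 : Type := EuclideanSpace ℝ (Fin 4)

/-- The Japanese bracket `⟨x⟩ = (1 + |x|²)^{1/2}`. -/
noncomputable def japaneseBracket {E : Type*} [NormedAddCommGroup E] (x : E) : ℝ :=
  Real.sqrt (1 + ‖x‖ ^ 2)

/-- `u` solves `(Δ² + V) u = 0` on `ℝ⁴` in the sense of distributions: the product `V u` is locally
integrable (so that it is a distribution), and `∫ u (Δ² f + V f) dx = 0` for all test functions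
`f ∈ C_c^∞(ℝ⁴)`. -/
def IsDistribSolution (V : R4 → ℝ) (u : R4 → ℂ) : Prop :=
  LocallyIntegrable (fun x => (V x : ℂ) * u x) volume ∧
    ∀ f : R4 → ℂ, ContDiff ℝ ∞ f → HasCompactSupport f →
      ∫ x, (u x * (Δ (Δ f)) x + (V x : ℂ) * u x * f x) = 0

theorem contDiff_laplacian_R4 {f : R4 → ℂ} (hf : ContDiff ℝ ∞ f) : ContDiff ℝ ∞ (Δ f) := by
  rw [InnerProductSpace.laplacian_eq_iteratedFDeriv_stdOrthonormalBasis]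
  refine ContDiff.sum fun i _ => ?_
  have h : ContDiff ℝ ∞ (iteratedFDeriv ℝ 2 f) :=
    hf.iteratedFDeriv_right (by norm_cast)
  exact (ContinuousMultilinearMap.apply ℝ (fun _ : Fin 2 => R4) ℂ
    ![stdOrthonormalBasis ℝ R4 i, stdOrthonormalBasis ℝ R4 i]).contDiff.comp h

theorem hasCompactSupport_laplacian_R4 {f : R4 → ℂ} (hf : HasCompactSupport f) :
    HasCompactSupport (Δ f) := by
  refine hf.mono' ?_
  intro x hx
  by_contra hx'
  apply hx
  have h0 : f =ᶠ[nhds x] fun _ => 0 := notMem_tsupport_iff_eventuallyEq.mp hx'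
  rw [(InnerProductSpace.laplacian_congr_nhds h0).eq_of_nhds]
  simp

theorem integrable_pairing {V : R4 → ℝ} {u f : R4 → ℂ} (hu : LocallyIntegrable u volume)
    (hVu : LocallyIntegrable (fun x => (V x : ℂ) * u x) volume)
    (hf : ContDiff ℝ ∞ f) (hc : HasCompactSupport f) :
    Integrable (fun x => u x * (Δ (Δ f)) x + (V x : ℂ) * u x * f x) volume := by
  have h1 := hu.integrable_smul_right_of_hasCompactSupport
    (contDiff_laplacian_R4 (contDiff_laplacian_R4 hf)).continuous
    (hasCompactSupport_laplacian_R4 (hasCompactSupport_laplacian_R4 hc))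
  have h2 := hVu.integrable_smul_right_of_hasCompactSupport hf.continuous hc
  exact h1.add h2

theorem IsDistribSolution.congr {V : R4 → ℝ} {u w : R4 → ℂ} (h : u =ᵐ[volume] w)
    (hu : IsDistribSolution V u) : IsDistribSolution V w := by
  refine ⟨(locallyIntegrable_congr ?_).1 hu.1, fun f hf hc => ?_⟩
  · filter_upwards [h] with x hx
    rw [hx]
  · rw [← hu.2 f hf hc]
    refine integral_congr_ae ?_
    filter_upwards [h] with x hx
    rw [hx]

/-- The space `𝒩_∞(H)`, `H = Δ² + V`, of all (complex-valued) `u ∈ L^∞(ℝ⁴)` with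
`(Δ² + V) u = 0` in the sense of distributions. -/
noncomputable def zeroResonanceSpace (V : R4 → ℝ) : Submodule ℂ (Lp ℂ ∞ (volume : Measure R4)) where
  carrier := {u | IsDistribSolution V u}
  zero_mem' := by
    have h : IsDistribSolution V (fun _ => (0 : ℂ)) :=
      ⟨by simpa using (locallyIntegrable_const (0 : ℂ)), fun f _ _ => by simp⟩
    exact h.congr (Lp.coeFn_zero ℂ ∞ volume).symm
  add_mem' := by
    intro u w hu hw
    refine IsDistribSolution.congr (u := fun x => u x + w x) (Lp.coeFn_add u w).symm ⟨?_, ?_⟩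
    · simp only [mul_add]
      exact hu.1.add hw.1
    · intro f hf hc
      have hul := (Lp.memLp u).locallyIntegrable le_top
      have hwl := (Lp.memLp w).locallyIntegrable le_top
      have h := integral_add (integrable_pairing hul hu.1 hf hc) (integrable_pairing hwl hw.1 hf hc)
      rw [hu.2 f hf hc, hw.2 f hf hc, add_zero] at h
      rw [← h]
      congr 1
      funext x
      ring
  smul_mem' := by
    intro c u hu
    refine IsDistribSolution.congr (u := fun x => c * u x) (Lp.coeFn_smul c u).symm ⟨?_, ?_⟩
    · have h := hu.1.smul c
      refine (locallyIntegrable_congr (Eventually.of_forall fun x => ?_)).1 h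
      simp only [Pi.smul_apply, smul_eq_mul]
      ring
    · intro f hf hc
      have h := integral_const_mul (μ := (volume : Measure R4)) c
        (fun x => u x * (Δ (Δ f)) x + (V x : ℂ) * u x * f x)
      rw [hu.2 f hf hc, mul_zero] at h
      rw [← h]
      congr 1
      funext x
      ring

/-! On `ℝ⁴` the logarithm is, up to a constant, the fundamental solution of `Δ²`; quantitatively,
`-Δ² log(|x|² + ε²) = 96 ε⁴ / (|x|² + ε²)⁴`, an approximate Dirac mass whose total mass `κ > 0` does
not depend on `ε`. Testing the equation for a bounded solution `u` with a logarithm cut off at scale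
`R` leaves an error term that does not vanish as `R → ∞`. It is asymptotically the same for two
centres `z` and `z'`, so it disappears from differences (`integral_mul_biharmonicBump_sub`). Letting
`ε → 0` weakly gives `κ u(z) = c + ∫ log|z - y|² V(y) u(y) dy` almost everywhere, with `c` constant.

The potential grows like `2 log⟨z⟩ ∫ V u`, so boundedness of `u` forces `∫ V u = 0`, and the kernel
may be replaced by `log|z - y| - log⟨z⟩`. The square of this kernel is integrable against `|V|`,
uniformly in `z`: its growth in `y` is absorbed by the weight, its singularity by the `L^q`
condition.

Finite dimension: Cauchy–Schwarz bounds the potential by the norm of `u` in `L²(|V| dx)`, and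
averaging over the unit ball bounds `c`. Hence on the solution space the sup norm is controlled by
the norm of `L²(|V| dx + 1_B dx)`, a finite measure, and Grothendieck's theorem
(`finiteDimensional_of_ae_norm_le`) applies.

Expansion: the second-order Taylor expansion of `log|x - y|²` at infinity is integrated against `V
u`. The term `log|x|²` drops out because `∫ V u = 0`, first moments of `V u` give `a`, second
moments give `A`, and the remainder is `O(|x|⁻³)` because `V` has a third moment with a logarithmic
weight (`abs_logRemainder_le`). -/

/-! ### Laplacian and bilaplacian of radial functions on `ℝ⁴` -/

theorem hasFDerivAt_comp_norm_sub_sq {ψ : ℝ → ℝ} {d : ℝ} (z x : R4)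
    (h : HasDerivAt ψ d (‖x - z‖ ^ 2)) :
    HasFDerivAt (fun y : R4 => ψ (‖y - z‖ ^ 2)) (d • (2 • innerSL ℝ (x - z))) x := by
  have h1 : HasFDerivAt (fun y : R4 => ‖y - z‖ ^ 2) (2 • innerSL ℝ (x - z)) x := by
    have := ((hasFDerivAt_id x).sub_const z).norm_sq
    simpa using this
  exact h.comp_hasFDerivAt x h1

/-- The Laplacian of a radial function on `ℝ⁴`, written as a function of `|x - z|²`. -/
theorem laplacian_comp_norm_sub_sq {ψ ψ₁ ψ₂ : ℝ → ℝ}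
    (h₁ : ∀ t, 0 ≤ t → HasDerivAt ψ (ψ₁ t) t) (h₂ : ∀ t, 0 ≤ t → HasDerivAt ψ₁ (ψ₂ t) t)
    (z : R4) :
    Δ (fun x : R4 => ψ (‖x - z‖ ^ 2)) =
      fun x => 4 * ‖x - z‖ ^ 2 * ψ₂ (‖x - z‖ ^ 2) + 8 * ψ₁ (‖x - z‖ ^ 2) := by
  have hf1 : fderiv ℝ (fun x : R4 => ψ (‖x - z‖ ^ 2)) =
      fun x => ψ₁ (‖x - z‖ ^ 2) • (2 • innerSL ℝ (x - z)) :=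
    funext fun x => (hasFDerivAt_comp_norm_sub_sq z x (h₁ _ (by positivity))).fderiv
  rw [InnerProductSpace.laplacian_eq_iteratedFDeriv_stdOrthonormalBasis]
  funext x
  have hf2 := (hasFDerivAt_comp_norm_sub_sq z x (h₂ _ (by positivity))).smul
    (((innerSL ℝ (E := R4)).hasFDerivAt.comp x ((hasFDerivAt_id x).sub_const z)).const_smul (2 : ℕ))
  have hf3 : ∀ e : R4, iteratedFDeriv ℝ 2 (fun x : R4 => ψ (‖x - z‖ ^ 2)) x ![e, e] =
      4 * ψ₂ (‖x - z‖ ^ 2) * inner ℝ (x - z) e ^ 2 + 2 * ψ₁ (‖x - z‖ ^ 2) * inner ℝ e e := by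
    intro e
    rw [iteratedFDeriv_two_apply, hf1]
    refine (congrArg (fun L : R4 →L[ℝ] R4 →L[ℝ] ℝ => L e e) hf2.fderiv).trans ?_
    change ψ₁ (‖x - z‖ ^ 2) * (2 • inner ℝ e e) +
      (ψ₂ (‖x - z‖ ^ 2) * (2 • inner ℝ (x - z) e)) * (2 • inner ℝ (x - z) e) = _
    simp only [nsmul_eq_mul, Nat.cast_ofNat]
    ring
  simp only [hf3]
  rw [Finset.sum_add_distrib, ← Finset.mul_sum, ← Finset.mul_sum]
  have e1 : ∑ i, inner ℝ (x - z) (stdOrthonormalBasis ℝ R4 i) ^ 2 = ‖x - z‖ ^ 2 := by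
    rw [← (stdOrthonormalBasis ℝ R4).sum_sq_norm_inner_left (x - z)]
    simp
  rw [e1]
  simp
  ring

theorem laplacian_ofReal_comp {f : R4 → ℝ} (hf : ContDiff ℝ ∞ f) :
    Δ (fun x => (f x : ℂ)) = fun x => ((Δ f x : ℝ) : ℂ) := by
  funext x
  have := (hf.contDiffAt (x := x)).of_le (m := 2) (by norm_cast) |>.laplacian_CLM_comp_left
    (l := Complex.ofRealCLM)
  exact this

/-- The bilaplacian of a radial function on `ℝ⁴`. -/
theorem bilaplacian_comp_norm_sub_sq {ψ ψ₁ ψ₂ ψ₃ ψ₄ : ℝ → ℝ}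
    (h₁ : ∀ t, 0 ≤ t → HasDerivAt ψ (ψ₁ t) t) (h₂ : ∀ t, 0 ≤ t → HasDerivAt ψ₁ (ψ₂ t) t)
    (h₃ : ∀ t, 0 ≤ t → HasDerivAt ψ₂ (ψ₃ t) t) (h₄ : ∀ t, 0 ≤ t → HasDerivAt ψ₃ (ψ₄ t) t)
    (z : R4) :
    Δ (Δ (fun x : R4 => ψ (‖x - z‖ ^ 2))) = fun x => 16 * (‖x - z‖ ^ 2) ^ 2 * ψ₄ (‖x - z‖ ^ 2) +
      96 * ‖x - z‖ ^ 2 * ψ₃ (‖x - z‖ ^ 2) + 96 * ψ₂ (‖x - z‖ ^ 2) := by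
  rw [laplacian_comp_norm_sub_sq h₁ h₂,
    laplacian_comp_norm_sub_sq (ψ := fun t => 4 * t * ψ₂ t + 8 * ψ₁ t)
      (ψ₁ := fun t => 4 * t * ψ₃ t + 12 * ψ₂ t) (ψ₂ := fun t => 4 * t * ψ₄ t + 16 * ψ₃ t)]
  · funext x
    ring
  · intro t ht
    refine ((((hasDerivAt_id t).const_mul 4).mul (h₃ t ht)).add ((h₂ t ht).const_mul 8)).congr_deriv ?_
    simp only [id]
    ring
  · intro t ht
    refine ((((hasDerivAt_id t).const_mul 4).mul (h₄ t ht)).add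
      ((h₃ t ht).const_mul 12)).congr_deriv ?_
    simp only [id]
    ring

/-! ### The cut-off logarithm and its bilaplacian error -/

/-- A smooth function on `(0, ∞)` that is `log` on `(0, 1]` and vanishes on `[e, ∞)`. -/
noncomputable def cutoffLog (s : ℝ) : ℝ := Real.log s * Real.smoothTransition (1 - Real.log s)

theorem cutoffLog_of_le_one {s : ℝ} (hs : 0 < s) (h : s ≤ 1) : cutoffLog s = Real.log s := by
  rw [cutoffLog, Real.smoothTransition.one_of_one_le, mul_one]
  linarith [Real.log_nonpos hs.le h]

theorem cutoffLog_of_exp_one_le {s : ℝ} (h : Real.exp 1 ≤ s) : cutoffLog s = 0 := by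
  rw [cutoffLog, Real.smoothTransition.zero_of_nonpos, mul_zero]
  have := (Real.le_log_iff_exp_le ((Real.exp_pos 1).trans_le h)).2 h
  linarith

theorem contDiffOn_cutoffLog : ContDiffOn ℝ ∞ cutoffLog (Set.Ioi 0) := by
  have h : ContDiffOn ℝ ∞ Real.log (Set.Ioi 0) := fun s hs =>
    (Real.contDiffAt_log.2 (ne_of_gt hs)).contDiffWithinAt
  exact h.mul (Real.smoothTransition.contDiff.comp_contDiffOn (contDiffOn_const.sub h))

theorem contDiffOn_iteratedDeriv_cutoffLog (k : ℕ) :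
    ContDiffOn ℝ ∞ (iteratedDeriv k cutoffLog) (Set.Ioi 0) := by
  induction k with
  | zero => simpa using contDiffOn_cutoffLog
  | succ k ih =>
    rw [iteratedDeriv_succ]
    exact ih.deriv_of_isOpen isOpen_Ioi (by simp)

theorem hasDerivAt_iteratedDeriv_cutoffLog (k : ℕ) {s : ℝ} (hs : 0 < s) :
    HasDerivAt (iteratedDeriv k cutoffLog) (iteratedDeriv (k + 1) cutoffLog s) s := by
  rw [iteratedDeriv_succ]
  exact (((contDiffOn_iteratedDeriv_cutoffLog k).contDiffAt (Ioi_mem_nhds hs)).differentiableAt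
    (by simp)).hasDerivAt

theorem iteratedDeriv_succ_cutoffLog_of_lt_one (k : ℕ) {s : ℝ} (hs : 0 < s) (h : s < 1) :
    iteratedDeriv (k + 1) cutoffLog s = (-1) ^ k * k.factorial * s ^ (-1 - k : ℤ) := by
  have h1 : cutoffLog =ᶠ[nhds s] Real.log := by
    filter_upwards [Ioo_mem_nhds hs h] with t ht using cutoffLog_of_le_one ht.1 ht.2.le
  rw [h1.iteratedDeriv_eq, iteratedDeriv_succ', Real.deriv_log', iteratedDeriv_eq_iterate,
    iter_deriv_inv]

theorem iteratedDeriv_cutoffLog_of_exp_one_lt (k : ℕ) {s : ℝ} (h : Real.exp 1 < s) :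
    iteratedDeriv k cutoffLog s = 0 := by
  have h1 : cutoffLog =ᶠ[nhds s] fun _ => 0 := by
    filter_upwards [Ioi_mem_nhds h] with t ht using cutoffLog_of_exp_one_le (le_of_lt ht)
  rw [h1.iteratedDeriv_eq]
  simp

/-- The cut-off logarithm is a Lipschitz function of `log s`. In differences of kernels the factor
`R²` inside the logarithm then cancels, which gives bounds uniform in `R`. -/
theorem exists_abs_cutoffLog_sub_le : ∃ C : ℝ, 0 ≤ C ∧ ∀ s t : ℝ,
    |cutoffLog s - cutoffLog t| ≤ C * |Real.log s - Real.log t| := by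
  let φ : ℝ → ℝ := fun l => l * Real.smoothTransition (1 - l)
  have hφ : ContDiff ℝ 1 φ :=
    contDiff_id.mul (Real.smoothTransition.contDiff.comp (contDiff_const.sub contDiff_id))
  have hc : Continuous (deriv φ) := hφ.continuous_deriv le_rfl
  obtain ⟨C, hC⟩ := (isCompact_Icc (a := (0 : ℝ)) (b := 1)).exists_bound_of_continuousOn
    hc.continuousOn
  -- The profile is the identity on `l < 0` and zero on `l > 1`; only `[0, 1]` needs compactness.
  have hb : ∀ l, ‖deriv φ l‖ ≤ max C 1 := by
    intro l
    rcases lt_or_ge l 0 with h0 | h0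
    · have h1 : φ =ᶠ[nhds l] id := by
        filter_upwards [Iio_mem_nhds h0] with t (ht : t < 0)
        simp only [φ, id]
        rw [Real.smoothTransition.one_of_one_le (by linarith), mul_one]
      rw [h1.deriv_eq]
      simp
    rcases lt_or_ge 1 l with h1 | h1
    · have h2 : φ =ᶠ[nhds l] fun _ => 0 := by
        filter_upwards [Ioi_mem_nhds h1] with t (ht : 1 < t)
        simp only [φ]
        rw [Real.smoothTransition.zero_of_nonpos (by linarith), mul_zero]
      rw [h2.deriv_eq]
      simp
    · exact (hC l ⟨h0, h1⟩).trans (le_max_left _ _)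
  refine ⟨max C 1, by positivity, fun s t => ?_⟩
  exact convex_univ.norm_image_sub_le_of_norm_deriv_le (𝕜 := ℝ) (f := φ)
    (fun l _ => (hφ.differentiable (by simp)).differentiableAt) (fun l _ => hb l)
    (Set.mem_univ (Real.log t)) (Set.mem_univ (Real.log s))

/-- The profile of the bilaplacian of `cutoffLog (|x|² + δ²)`, up to the sign and up to the
approximate Dirac mass at the origin, as a function of `τ = |x|²` and `s = |x|² + δ²`. -/
noncomputable def cutoffError (τ s : ℝ) : ℝ :=
  -(96 * (s - τ) ^ 2 / s ^ 4 + (16 * τ ^ 2 * iteratedDeriv 4 cutoffLog s +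
    96 * τ * iteratedDeriv 3 cutoffLog s + 96 * iteratedDeriv 2 cutoffLog s))

/-- In this range the profile is the exact logarithm, and `16τ²(-6/s⁴) + 96τ(2/s³) - 96/s²` equals
`-96(s - τ)²/s⁴`. -/
theorem cutoffError_of_lt_one {τ s : ℝ} (hs : 0 < s) (h : s < 1) : cutoffError τ s = 0 := by
  rw [cutoffError, iteratedDeriv_succ_cutoffLog_of_lt_one 3 hs h,
    iteratedDeriv_succ_cutoffLog_of_lt_one 2 hs h, iteratedDeriv_succ_cutoffLog_of_lt_one 1 hs h]
  have e4 : s ^ (-1 - ((3 : ℕ) : ℤ)) = (s ^ 4)⁻¹ := by rw [← zpow_natCast, ← zpow_neg]; norm_num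
  have e3 : s ^ (-1 - ((2 : ℕ) : ℤ)) = (s ^ 3)⁻¹ := by rw [← zpow_natCast, ← zpow_neg]; norm_num
  have e2 : s ^ (-1 - ((1 : ℕ) : ℤ)) = (s ^ 2)⁻¹ := by rw [← zpow_natCast, ← zpow_neg]; norm_num
  rw [e4, e3, e2]
  simp only [Nat.factorial]
  push_cast
  field_simp
  ring

theorem cutoffError_of_exp_one_lt {τ s : ℝ} (h : Real.exp 1 < s) :
    cutoffError τ s = -(96 * (s - τ) ^ 2 / s ^ 4) := by
  simp [cutoffError, iteratedDeriv_cutoffLog_of_exp_one_lt _ h]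

theorem continuousOn_cutoffError :
    ContinuousOn (fun p : ℝ × ℝ => cutoffError p.1 p.2) {p | 0 < p.2} := by
  have h (k : ℕ) : ContinuousOn (fun p : ℝ × ℝ => iteratedDeriv k cutoffLog p.2) {p | 0 < p.2} :=
    (contDiffOn_iteratedDeriv_cutoffLog k).continuousOn.comp continuousOn_snd fun p hp => hp
  have h2 := h 2
  have h3 := h 3
  have h4 := h 4
  unfold cutoffError
  refine ContinuousOn.neg (ContinuousOn.add (ContinuousOn.div (by fun_prop) (by fun_prop) ?_)
    (by fun_prop))
  intro p hp
  exact pow_ne_zero _ (ne_of_gt hp)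

/-- The bound is uniform in the regularization `δ`, and in `τ = |x|²` it is integrable over `ℝ⁴`.
The error vanishes for `s < 1`, is bounded by compactness for `1 ≤ s ≤ e`, and is the explicit tail
of the bump beyond. -/
theorem exists_abs_cutoffError_le : ∃ C : ℝ, 0 ≤ C ∧ ∀ τ δ : ℝ, 0 ≤ τ → 0 < δ → δ ≤ 1 →
    |cutoffError τ (τ + δ)| ≤ C * ((1 + τ) ^ 4)⁻¹ := by
  obtain ⟨B, hB⟩ := ((isCompact_Icc (a := (0 : ℝ)) (b := 3)).prod
    (isCompact_Icc (a := (1 : ℝ)) (b := 3))).exists_bound_of_continuousOn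
    (continuousOn_cutoffError.mono (fun p hp => zero_lt_one.trans_le hp.2.1))
  -- In the middle range `(τ, s)` lies in `[0, 3] × [1, 3]`, so `1 + τ ≤ 4`; in the tail `1 + τ ≤
  -- 2s` and `(s - τ)² = δ² ≤ 1`.
  refine ⟨max (B * 4 ^ 4) (96 * 2 ^ 4), by positivity, fun τ δ hτ h0 h1 => ?_⟩
  have hp : 0 < (1 + τ) ^ 4 := by positivity
  rw [← div_eq_mul_inv, le_div_iff₀ hp]
  have he : Real.exp 1 < 3 := Real.exp_one_lt_d9.trans (by norm_num)
  rcases lt_or_ge (τ + δ) 1 with h | h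
  · rw [cutoffError_of_lt_one (by linarith) h]
    simp
  rcases lt_or_ge (Real.exp 1) (τ + δ) with h' | h'
  · rw [cutoffError_of_exp_one_lt h', abs_neg, abs_of_nonneg (by positivity)]
    refine le_trans ?_ (le_max_right _ _)
    have e1 : (1 + τ) ^ 4 ≤ 2 ^ 4 * (τ + δ) ^ 4 := by
      rw [← mul_pow]
      exact pow_le_pow_left₀ (by positivity) (by linarith) 4
    have e2 : (τ + δ - τ) ^ 2 ≤ 1 := by
      rw [add_sub_cancel_left]
      exact pow_le_one₀ h0.le h1
    rw [div_mul_eq_mul_div, div_le_iff₀ (by positivity)]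
    nlinarith [pow_pos (h0.trans_le (by linarith : δ ≤ τ + δ)) 4]
  · refine le_trans ?_ (le_max_left _ _)
    have e1 : |cutoffError τ (τ + δ)| ≤ B := hB (τ, τ + δ) ⟨⟨hτ, by linarith⟩, ⟨h, by linarith⟩⟩
    refine mul_le_mul e1 (pow_le_pow_left₀ (by positivity) (by linarith) 4) hp.le
      ((abs_nonneg _).trans e1)

/-! ### The regularized test kernel and the vanishing of its error in differences -/

/-- A smooth compactly supported version of `log ((|x - z|² + ε²) / R²)`. -/
noncomputable def cutoffKernel (ε R : ℝ) (z x : R4) : ℝ :=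
  cutoffLog ((‖x - z‖ ^ 2 + ε ^ 2) / R ^ 2)

theorem contDiff_cutoffKernel {ε R : ℝ} (hε : 0 < ε) (hR : 0 < R) (z : R4) :
    ContDiff ℝ ∞ (cutoffKernel ε R z) := by
  refine contDiff_iff_contDiffAt.2 fun x => ?_
  have h0 : 0 < (‖x - z‖ ^ 2 + ε ^ 2) / R ^ 2 := by positivity
  have h1 : ContDiffAt ℝ ∞ (fun x : R4 => (‖x - z‖ ^ 2 + ε ^ 2) / R ^ 2) x :=
    ((((contDiff_id.sub contDiff_const).norm_sq ℝ).add contDiff_const).div_const _).contDiffAt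
  exact (contDiffOn_cutoffLog.contDiffAt (Ioi_mem_nhds h0)).comp x h1

theorem hasCompactSupport_cutoffKernel {ε R : ℝ} (hR : 0 < R) (z : R4) :
    HasCompactSupport (cutoffKernel ε R z) := by
  refine HasCompactSupport.intro (isCompact_closedBall z (2 * R)) fun x hx => ?_
  refine cutoffLog_of_exp_one_le ?_
  have h : 2 * R < ‖x - z‖ := by
    simpa [dist_eq_norm] using hx
  rw [le_div_iff₀ (by positivity)]
  have he : Real.exp 1 < 3 := Real.exp_one_lt_d9.trans (by norm_num)
  nlinarith [sq_nonneg ε]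

/-- The approximate Dirac mass `-Δ² log (|x|² + ε²)` (not normalized). -/
noncomputable def biharmonicBump (ε : ℝ) (x : R4) : ℝ := 96 * ε ^ 4 / (‖x‖ ^ 2 + ε ^ 2) ^ 4

theorem bilaplacian_cutoffKernel {ε R : ℝ} (hε : 0 < ε) (hR : 0 < R) (z : R4) :
    Δ (Δ (cutoffKernel ε R z)) = fun x => -(biharmonicBump ε (x - z) +
      (R ^ 4)⁻¹ * cutoffError (‖x - z‖ ^ 2 / R ^ 2) ((‖x - z‖ ^ 2 + ε ^ 2) / R ^ 2)) := by
  -- All four radial derivatives at once: each differentiation in `t = |x - z|²` brings out a factor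
  -- `R⁻²`.
  have key (k : ℕ) : ∀ t, 0 ≤ t → HasDerivAt
      (fun t : ℝ => ((R ^ 2)⁻¹) ^ k * iteratedDeriv k cutoffLog ((t + ε ^ 2) / R ^ 2))
      (((R ^ 2)⁻¹) ^ (k + 1) * iteratedDeriv (k + 1) cutoffLog ((t + ε ^ 2) / R ^ 2)) t := by
    intro t ht
    have h1 : HasDerivAt (fun t : ℝ => (t + ε ^ 2) / R ^ 2) ((R ^ 2)⁻¹) t := by
      simpa using ((hasDerivAt_id t).add_const (ε ^ 2)).div_const (R ^ 2)
    have h2 := ((hasDerivAt_iteratedDeriv_cutoffLog k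
      (show 0 < (t + ε ^ 2) / R ^ 2 by positivity)).comp t h1).const_mul (((R ^ 2)⁻¹) ^ k)
    refine h2.congr_deriv ?_
    ring
  have h0 := key 0
  simp only [pow_zero, one_mul, iteratedDeriv_zero] at h0
  have := bilaplacian_comp_norm_sub_sq h0 (key 1) (key 2) (key 3) z
  refine this.trans (funext fun x => ?_)
  have hp : ‖x - z‖ ^ 2 + ε ^ 2 ≠ 0 := by positivity
  simp only [biharmonicBump, cutoffError, Nat.reduceAdd]
  field_simp
  ring

theorem tendsto_cutoffError_div {ε : ℝ} (z : R4) {y : R4} (hy : y ≠ 0) :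
    Tendsto (fun R : ℝ => cutoffError (‖y - R⁻¹ • z‖ ^ 2) (‖y - R⁻¹ • z‖ ^ 2 + ε ^ 2 / R ^ 2)) atTop
      (nhds (cutoffError (‖y‖ ^ 2) (‖y‖ ^ 2))) := by
  have h1 : Tendsto (fun R : ℝ => ‖y - R⁻¹ • z‖ ^ 2) atTop (nhds (‖y‖ ^ 2)) := by
    have : Tendsto (fun R : ℝ => y - R⁻¹ • z) atTop (nhds (y - (0 : ℝ) • z)) :=
      tendsto_const_nhds.sub (tendsto_inv_atTop_zero.smul_const z)
    rw [zero_smul, sub_zero] at this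
    exact this.norm.pow 2
  have h2 : Tendsto (fun R : ℝ => ε ^ 2 / R ^ 2) atTop (nhds 0) :=
    tendsto_const_nhds.div_atTop (tendsto_pow_atTop two_ne_zero)
  have h3 := h1.add h2
  rw [add_zero] at h3
  have h4 : ContinuousAt (fun p : ℝ × ℝ => cutoffError p.1 p.2) (‖y‖ ^ 2, ‖y‖ ^ 2) :=
    continuousOn_cutoffError.continuousAt
      ((isOpen_lt continuous_const continuous_snd).mem_nhds (pow_pos (norm_pos_iff.2 hy) 2))
  have h5 := h1.prodMk_nhds h3
  have comp : ∀ F : ℝ → ℝ → ℝ, ContinuousAt (fun p : ℝ × ℝ => F p.1 p.2) (‖y‖ ^ 2, ‖y‖ ^ 2) →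
      Tendsto (fun R : ℝ => F (‖y - R⁻¹ • z‖ ^ 2) (‖y - R⁻¹ • z‖ ^ 2 + ε ^ 2 / R ^ 2)) atTop
        (nhds (F (‖y‖ ^ 2) (‖y‖ ^ 2))) :=
    fun F hF => Tendsto.comp (g := fun p : ℝ × ℝ => F p.1 p.2) hF h5
  exact comp cutoffError h4

theorem continuous_cutoffError_norm_sub {δ : ℝ} (hδ : 0 < δ) (w : R4) :
    Continuous fun y : R4 => cutoffError (‖y - w‖ ^ 2) (‖y - w‖ ^ 2 + δ) := by
  refine continuousOn_cutoffError.comp_continuous (f := fun y : R4 => (‖y - w‖ ^ 2, ‖y - w‖ ^ 2 + δ))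
    (by fun_prop) fun y => ?_
  simp only [Set.mem_ofPred_eq]
  positivity

theorem integrable_one_add_norm_sq_pow_four_inv :
    Integrable (fun x : R4 => ((1 + ‖x‖ ^ 2) ^ 4)⁻¹) volume := by
  have := integrable_rpow_neg_one_add_norm_sq (E := R4) (μ := volume) (r := 8) (by simp; norm_num)
  refine this.congr (Eventually.of_forall fun x => ?_)
  simp only
  rw [show (-8 / 2 : ℝ) = -((4 : ℕ) : ℝ) by norm_num, Real.rpow_neg (by positivity),
    Real.rpow_natCast]

theorem one_add_norm_sq_sub_le {y w : R4} (hw : ‖w‖ ≤ 1) :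
    ((1 + ‖y - w‖ ^ 2) ^ 4)⁻¹ ≤ 3 ^ 4 * ((1 + ‖y‖ ^ 2) ^ 4)⁻¹ := by
  have h : ‖y‖ ≤ ‖y - w‖ + ‖w‖ := by simpa using norm_add_le (y - w) w
  have h2 : 1 + ‖y‖ ^ 2 ≤ 3 * (1 + ‖y - w‖ ^ 2) := by
    nlinarith [norm_nonneg y, norm_nonneg (y - w), norm_nonneg w, sq_nonneg (‖y - w‖ - 1)]
  rw [← div_eq_mul_inv, le_div_iff₀ (by positivity), inv_mul_le_iff₀ (by positivity), mul_comm,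
    ← mul_pow]
  exact pow_le_pow_left₀ (by positivity) h2 4

/-- The factor `R⁻⁴` is the `L¹` normalization in dimension four. After `x = R y` the two errors are
centred at `z/R` and `z'/R`, both tending to `0`, and have the same pointwise limit; dominated
convergence kills the difference, although a single error need not become small. -/
theorem tendsto_integral_cutoffError_sub {ε : ℝ} (hε : 0 < ε) (z z' : R4) :
    Tendsto (fun R : ℝ => ∫ x : R4, |(R ^ 4)⁻¹ *
        cutoffError (‖x - z‖ ^ 2 / R ^ 2) ((‖x - z‖ ^ 2 + ε ^ 2) / R ^ 2) - (R ^ 4)⁻¹ *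
        cutoffError (‖x - z'‖ ^ 2 / R ^ 2) ((‖x - z'‖ ^ 2 + ε ^ 2) / R ^ 2)|) atTop (nhds 0) := by
  obtain ⟨C, hC0, hC⟩ := exists_abs_cutoffError_le
  let F : ℝ → R4 → ℝ := fun R y =>
    |cutoffError (‖y - R⁻¹ • z‖ ^ 2) (‖y - R⁻¹ • z‖ ^ 2 + ε ^ 2 / R ^ 2) -
      cutoffError (‖y - R⁻¹ • z'‖ ^ 2) (‖y - R⁻¹ • z'‖ ^ 2 + ε ^ 2 / R ^ 2)|
  have hF : Tendsto (fun R => ∫ y, F R y) atTop (nhds 0) := by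
    rw [← integral_zero R4 ℝ (μ := volume)]
    have hlarge : ∀ᶠ R : ℝ in atTop, 0 < R ∧ ε ≤ R ∧ ‖z‖ ≤ R ∧ ‖z'‖ ≤ R :=
      (eventually_gt_atTop 0).and ((eventually_ge_atTop _).and
        ((eventually_ge_atTop _).and (eventually_ge_atTop _)))
    refine tendsto_integral_filter_of_dominated_convergence
      (fun y => 2 * C * 3 ^ 4 * ((1 + ‖y‖ ^ 2) ^ 4)⁻¹) ?_ ?_
      (integrable_one_add_norm_sq_pow_four_inv.const_mul _) ?_
    · filter_upwards [hlarge] with R hR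
      have hδ : 0 < ε ^ 2 / R ^ 2 := div_pos (pow_pos hε 2) (pow_pos hR.1 2)
      exact ((continuous_cutoffError_norm_sub hδ _).sub
        (continuous_cutoffError_norm_sub hδ _)).abs.aestronglyMeasurable
    · filter_upwards [hlarge] with R hR
      refine Eventually.of_forall fun y => ?_
      have hδ : 0 < ε ^ 2 / R ^ 2 := div_pos (pow_pos hε 2) (pow_pos hR.1 2)
      have hδ1 : ε ^ 2 / R ^ 2 ≤ 1 :=
        (div_le_one (pow_pos hR.1 2)).2 (pow_le_pow_left₀ hε.le hR.2.1 2)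
      have hw : ∀ w : R4, ‖w‖ ≤ R → |cutoffError (‖y - R⁻¹ • w‖ ^ 2)
          (‖y - R⁻¹ • w‖ ^ 2 + ε ^ 2 / R ^ 2)| ≤ C * (3 ^ 4 * ((1 + ‖y‖ ^ 2) ^ 4)⁻¹) := by
        intro w hw
        refine (hC _ _ (by positivity) hδ hδ1).trans (mul_le_mul_of_nonneg_left ?_ hC0)
        refine one_add_norm_sq_sub_le ?_
        rw [norm_smul, norm_inv, Real.norm_of_nonneg hR.1.le, inv_mul_le_iff₀ hR.1, mul_one]
        exact hw
      rw [Real.norm_eq_abs, abs_abs]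
      refine (abs_sub _ _).trans ((add_le_add (hw z hR.2.2.1) (hw z' hR.2.2.2)).trans (le_of_eq ?_))
      ring
    · have h0 : ∀ᵐ y : R4, y ≠ 0 := by
        simp [ae_iff]
      filter_upwards [h0] with y hy
      have := ((tendsto_cutoffError_div (ε := ε) z hy).sub
        (tendsto_cutoffError_div (ε := ε) z' hy)).abs
      simpa using this
  refine hF.congr' ?_
  filter_upwards [eventually_gt_atTop 0] with R hR
  -- Rescaling by `R` turns the integral of the statement into that of `F R`.
  have h := Measure.integral_comp_inv_smul_of_nonneg volume (F R) hR.le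
  rw [finrank_euclideanSpace_fin, smul_eq_mul] at h
  rw [← inv_mul_cancel_left₀ (pow_pos hR 4).ne' (∫ y, F R y), ← h, ← integral_const_mul]
  congr 1
  funext x
  have hn : ∀ w : R4, ‖R⁻¹ • x - R⁻¹ • w‖ ^ 2 = ‖x - w‖ ^ 2 / R ^ 2 := by
    intro w
    rw [← smul_sub, norm_smul, norm_inv, Real.norm_of_nonneg hR.le]
    field_simp
  simp only [F, hn, ← add_div]
  rw [← mul_sub, abs_mul, abs_of_pos (inv_pos.2 (pow_pos hR 4))]

theorem continuous_biharmonicBump {ε : ℝ} (hε : 0 < ε) : Continuous (biharmonicBump ε) := by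
  unfold biharmonicBump
  refine continuous_const.div (by fun_prop) fun x => ?_
  positivity

theorem integrable_biharmonicBump {ε : ℝ} (hε : 0 < ε) : Integrable (biharmonicBump ε) volume := by
  have hm : 0 < min 1 (ε ^ 2) := by positivity
  refine (integrable_one_add_norm_sq_pow_four_inv.const_mul
    (96 * ε ^ 4 / (min 1 (ε ^ 2)) ^ 4)).mono'
    (continuous_biharmonicBump hε).aestronglyMeasurable (Eventually.of_forall fun x => ?_)
  rw [Real.norm_of_nonneg (by unfold biharmonicBump; positivity), biharmonicBump,
    ← div_eq_mul_inv, div_div, ← mul_pow]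
  refine div_le_div_of_nonneg_left (by positivity) (by positivity)
    (pow_le_pow_left₀ (by positivity) ?_ 4)
  rw [mul_add, mul_one, add_comm]
  exact add_le_add (mul_le_of_le_one_left (by positivity) (min_le_left _ _)) (min_le_right _ _)

/-! ### Testing the equation with the kernel and letting `R → ∞` -/

theorem integral_mul_biharmonicBump_add {V : R4 → ℝ} {u : R4 → ℂ} {M ε R : ℝ}
    (hu : AEStronglyMeasurable u volume) (hM : ∀ᵐ x, ‖u x‖ ≤ M) (hV : IsDistribSolution V u)
    (hε : 0 < ε) (hR : 0 < R) (z : R4) :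
    let e : R4 → ℝ := fun x => (R ^ 4)⁻¹ *
      cutoffError (‖x - z‖ ^ 2 / R ^ 2) ((‖x - z‖ ^ 2 + ε ^ 2) / R ^ 2)
    Integrable e volume ∧ Integrable (fun x => V x * u x * cutoffKernel ε R z x) volume ∧
    (∫ x, u x * biharmonicBump ε (x - z)) + ∫ x, u x * e x =
      ∫ x, V x * u x * cutoffKernel ε R z x := by
  intro e
  let f : R4 → ℂ := fun x => (cutoffKernel ε R z x : ℂ)
  have hk := contDiff_cutoffKernel hε hR z
  have hf : ContDiff ℝ ∞ f := Complex.ofRealCLM.contDiff.comp hk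
  have hc : HasCompactSupport f :=
    (hasCompactSupport_cutoffKernel (ε := ε) hR z).comp_left Complex.ofReal_zero
  have hΔk : ContDiff ℝ ∞ (Δ (cutoffKernel ε R z)) := by
    rw [InnerProductSpace.laplacian_eq_iteratedFDeriv_stdOrthonormalBasis]
    refine ContDiff.sum fun i _ => ?_
    have h : ContDiff ℝ ∞ (iteratedFDeriv ℝ 2 (cutoffKernel ε R z)) :=
      hk.iteratedFDeriv_right (by norm_cast)
    exact (ContinuousMultilinearMap.apply ℝ (fun _ : Fin 2 => R4) ℝ
      ![stdOrthonormalBasis ℝ R4 i, stdOrthonormalBasis ℝ R4 i]).contDiff.comp h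
  have hΔ : Δ (Δ f) = fun x => ((-(biharmonicBump ε (x - z) + e x) : ℝ) : ℂ) := by
    rw [laplacian_ofReal_comp hk, laplacian_ofReal_comp hΔk, bilaplacian_cutoffKernel hε hR z]
  have hΔint : Integrable (Δ (Δ f)) volume :=
    (contDiff_laplacian_R4 (contDiff_laplacian_R4 hf)).continuous.integrable_of_hasCompactSupport
      (hasCompactSupport_laplacian_R4 (hasCompactSupport_laplacian_R4 hc))
  have hb : Integrable (fun x => biharmonicBump ε (x - z)) volume :=
    (integrable_biharmonicBump hε).comp_sub_right z
  -- The error is minus the bilaplacian of the test function, minus the bump, and both are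
  -- integrable.
  have he : Integrable e volume := by
    rw [hΔ] at hΔint
    have h1 := hΔint.re.neg.sub hb
    refine h1.congr (Eventually.of_forall fun x => ?_)
    simp
  have hmul : ∀ g : R4 → ℝ, Integrable g volume → Integrable (fun x => u x * g x) volume :=
    fun g hg => hg.ofReal.bdd_mul hu hM
  have hvk : Integrable (fun x => V x * u x * cutoffKernel ε R z x) volume :=
    hV.1.integrable_smul_right_of_hasCompactSupport hf.continuous hc
  refine ⟨he, hvk, ?_⟩
  have h := hV.2 f hf hc
  have h2 : (fun x => u x * (Δ (Δ f)) x + (V x : ℂ) * u x * f x) =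
      fun x => V x * u x * cutoffKernel ε R z x -
        (u x * biharmonicBump ε (x - z) + u x * e x) := by
    funext x
    rw [hΔ]
    push_cast
    ring
  have hadd : Integrable (fun x => u x * biharmonicBump ε (x - z) + u x * e x) volume :=
    (hmul _ hb).add (hmul _ he)
  rw [h2, integral_sub hvk hadd, integral_add (hmul _ hb) (hmul _ he),
    sub_eq_zero] at h
  exact h.symm

/-- For fixed `ε` a difference of regularized logarithms is bounded in `x`, so integrability of `V
u` alone suffices for dominated convergence. -/
theorem abs_log_norm_sub_sq_add_sub_le {ε : ℝ} (hε : 0 < ε) (z z' x : R4) :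
    |Real.log (‖x - z‖ ^ 2 + ε ^ 2) - Real.log (‖x - z'‖ ^ 2 + ε ^ 2)| ≤
      Real.log (2 + 2 * ‖z - z'‖ ^ 2 / ε ^ 2) := by
  have key : ∀ z z' : R4, Real.log (‖x - z‖ ^ 2 + ε ^ 2) - Real.log (‖x - z'‖ ^ 2 + ε ^ 2) ≤
      Real.log (2 + 2 * ‖z - z'‖ ^ 2 / ε ^ 2) := by
    intro z z'
    rw [← Real.log_div (by positivity) (by positivity)]
    refine Real.log_le_log (by positivity) ?_
    rw [div_le_iff₀ (by positivity)]
    have h : ‖x - z‖ ≤ ‖x - z'‖ + ‖z - z'‖ := by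
      rw [norm_sub_rev z z']
      simpa using norm_add_le (x - z') (z' - z)
    have h1 : ‖x - z‖ ^ 2 ≤ 2 * ‖x - z'‖ ^ 2 + 2 * ‖z - z'‖ ^ 2 := by
      nlinarith [norm_nonneg (x - z), sq_nonneg (‖x - z'‖ - ‖z - z'‖)]
    have h2 : 2 * ‖z - z'‖ ^ 2 ≤ 2 * ‖z - z'‖ ^ 2 / ε ^ 2 * (‖x - z'‖ ^ 2 + ε ^ 2) := by
      rw [div_mul_eq_mul_div, le_div_iff₀ (by positivity)]
      exact mul_le_mul_of_nonneg_left (le_add_of_nonneg_left (by positivity)) (by positivity)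
    nlinarith [pow_pos hε 2]
  refine abs_le.2 ⟨?_, key z z'⟩
  have := key z' z
  rw [norm_sub_rev z' z] at this
  linarith

theorem tendsto_cutoffKernel_sub {ε : ℝ} (hε : 0 < ε) (z z' x : R4) :
    Tendsto (fun R : ℝ => cutoffKernel ε R z x - cutoffKernel ε R z' x) atTop
      (nhds (Real.log (‖x - z‖ ^ 2 + ε ^ 2) - Real.log (‖x - z'‖ ^ 2 + ε ^ 2))) := by
  refine tendsto_const_nhds.congr' ?_
  have hlarge : ∀ a : ℝ, ∀ᶠ R : ℝ in atTop, a ≤ R ^ 2 := fun a =>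
    (tendsto_pow_atTop two_ne_zero).eventually_ge_atTop a
  filter_upwards [eventually_gt_atTop 0, hlarge (‖x - z‖ ^ 2 + ε ^ 2),
    hlarge (‖x - z'‖ ^ 2 + ε ^ 2)] with R hR h1 h2
  rw [cutoffKernel, cutoffKernel, cutoffLog_of_le_one (by positivity)
    ((div_le_one (by positivity)).2 h1), cutoffLog_of_le_one (by positivity)
    ((div_le_one (by positivity)).2 h2), Real.log_div (by positivity) (by positivity),
    Real.log_div (by positivity) (by positivity)]
  ring

/-- Subtracting the tested equations at `z` and `z'` removes the error as `R → ∞`, since `u` is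
bounded and the errors approach each other in `L¹`. What remains is the mollified representation
formula up to a constant. -/
theorem integral_mul_biharmonicBump_sub {V : R4 → ℝ} {u : R4 → ℂ} {M ε : ℝ}
    (hu : AEStronglyMeasurable u volume) (hM : ∀ᵐ x, ‖u x‖ ≤ M) (hV : IsDistribSolution V u)
    (hVu : Integrable (fun x => V x * u x) volume) (hε : 0 < ε) (z z' : R4) :
    (∫ x, u x * biharmonicBump ε (x - z)) - ∫ x, u x * biharmonicBump ε (x - z') =
      ∫ x, V x * u x * ((Real.log (‖x - z‖ ^ 2 + ε ^ 2) -
        Real.log (‖x - z'‖ ^ 2 + ε ^ 2) : ℝ) : ℂ) := by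
  let e : R4 → ℝ → R4 → ℝ := fun z R x => (R ^ 4)⁻¹ *
      cutoffError (‖x - z‖ ^ 2 / R ^ 2) ((‖x - z‖ ^ 2 + ε ^ 2) / R ^ 2)
  have h1 : Tendsto (fun R : ℝ => (∫ x, u x * (e z R x - e z' R x : ℝ))) atTop (nhds 0) := by
    refine squeeze_zero_norm' ?_ (by
      simpa using (tendsto_integral_cutoffError_sub hε z z').const_mul M)
    filter_upwards [eventually_gt_atTop 0] with R hR
    have i1 := (integral_mul_biharmonicBump_add hu hM hV hε hR z).1
    have i2 := (integral_mul_biharmonicBump_add hu hM hV hε hR z').1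
    rw [← integral_const_mul]
    refine norm_integral_le_of_norm_le ((i1.sub i2).abs.const_mul M) ?_
    filter_upwards [hM] with x hx
    rw [norm_mul, Complex.norm_real]
    exact mul_le_mul_of_nonneg_right hx (norm_nonneg _)
  have h2 : Tendsto (fun R : ℝ => ∫ x, V x * u x *
        ((cutoffKernel ε R z x - cutoffKernel ε R z' x : ℝ) : ℂ)) atTop
      (nhds (∫ x, V x * u x * ((Real.log (‖x - z‖ ^ 2 + ε ^ 2) -
        Real.log (‖x - z'‖ ^ 2 + ε ^ 2) : ℝ) : ℂ))) := by
    obtain ⟨C, hC0, hC⟩ := exists_abs_cutoffLog_sub_le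
    refine tendsto_integral_filter_of_dominated_convergence
      (fun x => ‖V x * u x‖ * (C * Real.log (2 + 2 * ‖z - z'‖ ^ 2 / ε ^ 2))) ?_ ?_
      (hVu.norm.mul_const _) ?_
    · filter_upwards [eventually_gt_atTop 0] with R hR
      exact hVu.1.mul (Complex.continuous_ofReal.comp ((contDiff_cutoffKernel hε hR z).continuous.sub
        (contDiff_cutoffKernel hε hR z').continuous)).aestronglyMeasurable
    · filter_upwards [eventually_gt_atTop 0] with R hR
      refine Eventually.of_forall fun x => ?_
      rw [norm_mul, Complex.norm_real]
      refine mul_le_mul_of_nonneg_left ((hC _ _).trans (mul_le_mul_of_nonneg_left ?_ hC0))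
        (norm_nonneg _)
      rw [Real.log_div (by positivity) (by positivity), Real.log_div (by positivity) (by positivity),
        sub_sub_sub_cancel_right]
      exact abs_log_norm_sub_sq_add_sub_le hε z z' x
    · refine Eventually.of_forall fun x => ?_
      exact ((Complex.continuous_ofReal.tendsto _).comp
        (tendsto_cutoffKernel_sub hε z z' x)).const_mul _
  refine tendsto_nhds_unique (tendsto_const_nhds.congr' ?_) (by simpa using h2.sub h1)
  filter_upwards [eventually_gt_atTop 0] with R hR
  obtain ⟨i1, j1, k1⟩ := integral_mul_biharmonicBump_add hu hM hV hε hR z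
  obtain ⟨i2, j2, k2⟩ := integral_mul_biharmonicBump_add hu hM hV hε hR z'
  have hsub : ∫ x, (u x * e z R x - u x * e z' R x) =
      (∫ x, u x * e z R x) - ∫ x, u x * e z' R x :=
    integral_sub (i1.ofReal.bdd_mul hu hM) (i2.ofReal.bdd_mul hu hM)
  simp only [mul_sub]
  rw [integral_sub j1 j2, hsub, ← k1, ← k2]
  ring

/-! ### Uniform bounds for potentials with a logarithmic singularity -/

theorem MeasureTheory.MemLp.exists_ae_norm_le {α F : Type*} [MeasurableSpace α] {μ : Measure α}
    [NormedAddCommGroup F] {f : α → F} (hf : MemLp f ∞ μ) : ∃ M : ℝ, 0 ≤ M ∧ ∀ᵐ x ∂μ, ‖f x‖ ≤ M := by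
  refine ⟨(eLpNorm f ∞ μ).toReal, ENNReal.toReal_nonneg, ?_⟩
  filter_upwards [enorm_ae_le_eLpNormEssSup f μ] with x hx
  rw [← toReal_enorm]
  exact ENNReal.toReal_mono hf.2.ne (by simpa using hx)

/-- The negative part of the logarithm. -/
noncomputable def negLog (r : ℝ) : ℝ := max 0 (-Real.log r)

theorem negLog_nonneg (r : ℝ) : 0 ≤ negLog r := le_max_left _ _

theorem neg_log_le_negLog (r : ℝ) : -Real.log r ≤ negLog r := le_max_right _ _

theorem measurable_negLog : Measurable negLog := by
  unfold negLog
  fun_prop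

theorem negLog_of_one_le {r : ℝ} (h : 1 ≤ r) : negLog r = 0 := by
  rw [negLog, max_eq_left]
  linarith [Real.log_nonneg h]

theorem integrable_negLog_norm_rpow {p : ℝ} (hp : 0 < p) :
    Integrable (fun x : R4 => negLog ‖x‖ ^ p) volume := by
  have h : IntegrableOn (fun x : R4 => negLog ‖x‖ ^ p) (Metric.ball 0 1) volume := by
    rw [integrableOn_fun_norm_addHaar (E := R4) volume (f := fun r => negLog r ^ p)]
    -- In polar coordinates the density is `r³ |log r|^p`. The constant comes from `|log r| r^{1/p}
    -- ≤ p` raised to the power `p`, with `r³ ≤ r`.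
    refine Measure.integrableOn_of_bounded (M := p ^ p) (by simp) ?_ ?_
    · exact ((measurable_id.pow_const _).smul (measurable_negLog.pow_const p)).aestronglyMeasurable
    · refine (ae_restrict_iff' measurableSet_Ioo).2 (Eventually.of_forall fun y hy => ?_)
      have hl : negLog y = |Real.log y| := by
        rw [negLog, max_eq_right (neg_nonneg.2 (Real.log_nonpos hy.1.le hy.2.le)),
          abs_of_nonpos (Real.log_nonpos hy.1.le hy.2.le)]
      have h1 := (Real.abs_log_mul_self_rpow_lt y p⁻¹ hy.1 hy.2.le (inv_pos.2 hp)).le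
      rw [abs_mul, abs_of_pos (Real.rpow_pos_of_pos hy.1 _), one_div, inv_inv] at h1
      have h2 := Real.rpow_le_rpow (mul_nonneg (abs_nonneg _) (Real.rpow_nonneg hy.1.le _)) h1 hp.le
      rw [Real.mul_rpow (abs_nonneg _) (Real.rpow_nonneg hy.1.le _), ← Real.rpow_mul hy.1.le,
        inv_mul_cancel₀ hp.ne', Real.rpow_one] at h2
      rw [finrank_euclideanSpace_fin, hl, smul_eq_mul, norm_mul, norm_pow,
        Real.norm_of_nonneg hy.1.le, Real.norm_of_nonneg (Real.rpow_nonneg (abs_nonneg _) _)]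
      refine le_trans ?_ h2
      rw [mul_comm]
      refine mul_le_mul_of_nonneg_left ?_ (Real.rpow_nonneg (abs_nonneg _) _)
      exact pow_le_of_le_one hy.1.le hy.2.le (by norm_num)
  refine (integrableOn_iff_integrable_of_support_subset fun x hx => ?_).1 h
  by_contra hx'
  apply hx
  have : 1 ≤ ‖x‖ := by simpa using hx'
  change negLog ‖x‖ ^ p = 0
  rw [negLog_of_one_le this, Real.zero_rpow hp.ne']

/-- A density in `L¹ ∩ L^q`, `q > 1`, has uniformly bounded logarithmic potentials. -/
theorem exists_integral_negLog_pow_mul_le {W : R4 → ℝ} {q : ℝ≥0∞} (hq : 1 < q)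
    (hW1 : Integrable W volume) (hWq : MemLp W q volume) {k : ℕ} (hk : k ≠ 0) :
    ∃ C : ℝ, ∀ x : R4, Integrable (fun y => negLog ‖x - y‖ ^ k * |W y|) volume ∧
      ∫ y, negLog ‖x - y‖ ^ k * |W y| ≤ C := by
  -- A majorant made of a translated function and a fixed one has an integral independent of `x`.
  -- For finite `q` it is Young's inequality with conjugate exponents.
  suffices h : ∃ g₁ g₂ : R4 → ℝ, Integrable g₁ volume ∧ Integrable g₂ volume ∧
      ∀ x, ∀ᵐ y, negLog ‖x - y‖ ^ k * |W y| ≤ g₁ (x - y) + g₂ y by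
    obtain ⟨g₁, g₂, h₁, h₂, hle⟩ := h
    refine ⟨(∫ y, g₁ y) + ∫ y, g₂ y, fun x => ?_⟩
    have hi : Integrable (fun y => g₁ (x - y) + g₂ y) volume := (h₁.comp_sub_left x).add h₂
    have hm : AEStronglyMeasurable (fun y => negLog ‖x - y‖ ^ k * |W y|) volume :=
      AEStronglyMeasurable.mul
        ((measurable_negLog.comp (by fun_prop)).pow_const k).aestronglyMeasurable
        hW1.abs.aestronglyMeasurable
    have hi' : Integrable (fun y => negLog ‖x - y‖ ^ k * |W y|) volume := by
      refine hi.mono' hm ?_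
      filter_upwards [hle x] with y hy
      rwa [Real.norm_of_nonneg (mul_nonneg (pow_nonneg (negLog_nonneg _) k) (abs_nonneg _))]
    refine ⟨hi', (integral_mono_ae hi' hi (hle x)).trans (le_of_eq ?_)⟩
    rw [integral_add (h₁.comp_sub_left x) h₂, integral_sub_left_eq_self g₁ volume x]
  have hk0 : (0 : ℝ) < k := by positivity
  rcases eq_or_ne q ∞ with rfl | hq'
  · obtain ⟨M, -, hM⟩ := hWq.exists_ae_norm_le
    refine ⟨fun y => negLog ‖y‖ ^ k * M, fun _ => 0, ?_, integrable_zero _ _ _, fun x => ?_⟩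
    · simpa using (integrable_negLog_norm_rpow hk0).mul_const M
    · filter_upwards [hM] with y hy
      rw [add_zero]
      exact mul_le_mul_of_nonneg_left hy (pow_nonneg (negLog_nonneg _) k)
  · have h1q : 1 < q.toReal := by
      rw [← ENNReal.toReal_one]
      exact (ENNReal.toReal_lt_toReal ENNReal.one_ne_top hq').2 hq
    have hc := (Real.HolderConjugate.conjExponent h1q).symm
    have hp : 0 < Real.conjExponent q.toReal := hc.pos
    refine ⟨fun y => negLog ‖y‖ ^ (k * Real.conjExponent q.toReal) / Real.conjExponent q.toReal,
      fun y => |W y| ^ q.toReal / q.toReal,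
      (integrable_negLog_norm_rpow (mul_pos hk0 hp)).div_const _,
      (hWq.integrable_norm_rpow (zero_lt_one.trans hq).ne' hq').div_const _, fun x => ?_⟩
    refine Eventually.of_forall fun y => ?_
    simp only
    rw [Real.rpow_mul (negLog_nonneg _), Real.rpow_natCast]
    exact Real.young_inequality_of_nonneg (pow_nonneg (negLog_nonneg _) k) (abs_nonneg _) hc

/-! ### Weights and comparison of `log|x - y|` with `log⟨x⟩` -/

theorem one_le_japaneseBracket {E : Type*} [NormedAddCommGroup E] (x : E) :
    1 ≤ japaneseBracket x := by
  rw [japaneseBracket, Real.one_le_sqrt]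
  linarith [sq_nonneg ‖x‖]

theorem japaneseBracket_pos {E : Type*} [NormedAddCommGroup E] (x : E) :
    0 < japaneseBracket x := zero_lt_one.trans_le (one_le_japaneseBracket x)

theorem japaneseBracket_sq {E : Type*} [NormedAddCommGroup E] (x : E) :
    japaneseBracket x ^ 2 = 1 + ‖x‖ ^ 2 := Real.sq_sqrt (by positivity)

theorem norm_le_japaneseBracket {E : Type*} [NormedAddCommGroup E] (x : E) :
    ‖x‖ ≤ japaneseBracket x := Real.le_sqrt_of_sq_le (by linarith)

theorem continuous_japaneseBracket {E : Type*} [NormedAddCommGroup E] :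
    Continuous (japaneseBracket : E → ℝ) := by
  unfold japaneseBracket
  fun_prop

theorem norm_sub_le_two_mul_japaneseBracket (x y : R4) :
    ‖x - y‖ ≤ 2 * (japaneseBracket x * japaneseBracket y) := by
  have h1 := norm_sub_le x y
  have hx := norm_le_japaneseBracket x
  have hy := norm_le_japaneseBracket y
  have hx1 := one_le_japaneseBracket x
  have hy1 := one_le_japaneseBracket y
  nlinarith

theorem japaneseBracket_le_two_mul (x y : R4) :
    japaneseBracket x ≤ 2 * (japaneseBracket y * max 1 ‖x - y‖) := by
  have h1 : ‖x‖ ≤ ‖x - y‖ + ‖y‖ := by simpa using norm_add_le (x - y) y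
  have h2 := le_max_left 1 ‖x - y‖
  have h3 := le_max_right 1 ‖x - y‖
  refine abs_le_of_sq_le_sq' ?_ (by positivity [japaneseBracket_pos y]) |>.2
  rw [mul_pow, mul_pow, japaneseBracket_sq, japaneseBracket_sq]
  set m := max 1 ‖x - y‖
  have h4 : ‖x‖ ≤ m + ‖y‖ := by linarith
  have h5 : ‖x‖ ^ 2 ≤ (m + ‖y‖) ^ 2 := pow_le_pow_left₀ (norm_nonneg _) h4 2
  have h6 : 1 ≤ m ^ 2 := one_le_pow₀ h2
  nlinarith [sq_nonneg (m - ‖y‖), mul_nonneg (sq_nonneg ‖y‖) (sub_nonneg.2 h6), sq_nonneg ‖y‖]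

/-- Subtracting `log⟨x⟩` removes all growth in `x`: the bounds `|x - y| ≤ 2⟨x⟩⟨y⟩` and `⟨x⟩ ≤ 2⟨y⟩
max(1, |x - y|)` leave growth in `y` and the singularity only. -/
theorem abs_log_norm_sub_sub_log_japaneseBracket_le (x y : R4) :
    |Real.log ‖x - y‖ - Real.log (japaneseBracket x)| ≤
      Real.log 2 + Real.log (japaneseBracket y) + negLog ‖x - y‖ := by
  have hx := japaneseBracket_pos x
  have hy := japaneseBracket_pos y
  have hlx := Real.log_nonneg (one_le_japaneseBracket x)
  have hly := Real.log_nonneg (one_le_japaneseBracket y)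
  have hl2 := Real.log_nonneg (one_le_two : (1 : ℝ) ≤ 2)
  have hn := negLog_nonneg ‖x - y‖
  refine abs_le.2 ⟨?_, ?_⟩
  · have h := Real.log_le_log hx (japaneseBracket_le_two_mul x y)
    have hm : 0 < max 1 ‖x - y‖ := lt_max_of_lt_left one_pos
    rw [Real.log_mul two_ne_zero (mul_pos hy hm).ne', Real.log_mul hy.ne' hm.ne'] at h
    have h2 : Real.log (max 1 ‖x - y‖) ≤ Real.log ‖x - y‖ + negLog ‖x - y‖ := by
      rcases le_total 1 ‖x - y‖ with h1 | h1
      · rw [max_eq_right h1]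
        linarith
      · rw [max_eq_left h1, Real.log_one]
        linarith [neg_log_le_negLog ‖x - y‖]
    linarith
  · rcases (norm_nonneg (x - y)).eq_or_lt with h0 | h0
    -- At `x = y` the logarithm takes its default value `0`, and the bound still holds.
    · rw [← h0, Real.log_zero]
      rw [← h0] at hn
      linarith
    · have h := Real.log_le_log h0 (norm_sub_le_two_mul_japaneseBracket x y)
      rw [Real.log_mul two_ne_zero (mul_pos hx hy).ne', Real.log_mul hx.ne' hy.ne'] at h
      linarith

/-- The weight `⟨log |x|⟩² ⟨x⟩³`. -/
noncomputable def logWeight (x : R4) : ℝ :=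
  japaneseBracket (Real.log ‖x‖) ^ 2 * japaneseBracket x ^ 3

theorem measurable_logWeight : Measurable logWeight :=
  ((continuous_japaneseBracket.measurable.comp (Real.measurable_log.comp measurable_norm)).pow_const
    2).mul (continuous_japaneseBracket.measurable.pow_const 3)

theorem japaneseBracket_log_mul_le_logWeight (x : R4) :
    japaneseBracket (Real.log ‖x‖) * japaneseBracket x ^ 3 ≤ logWeight x := by
  refine mul_le_mul_of_nonneg_right ?_ (pow_nonneg (japaneseBracket_pos x).le 3)
  exact le_self_pow₀ (one_le_japaneseBracket _) two_ne_zero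

theorem japaneseBracket_pow_three_le_logWeight (x : R4) :
    japaneseBracket x ^ 3 ≤ logWeight x :=
  le_mul_of_one_le_left (pow_nonneg (japaneseBracket_pos x).le 3)
    (one_le_pow₀ (one_le_japaneseBracket _))

theorem one_le_logWeight (x : R4) : 1 ≤ logWeight x :=
  (one_le_pow₀ (one_le_japaneseBracket x)).trans (japaneseBracket_pow_three_le_logWeight x)

/-- Measurable and decaying potentials in the sense of the weighted `L¹ ∩ L^q` condition, with the
consequences of that condition that enter the analysis of zero resonances. -/
structure IsLogPotential (V : R4 → ℝ) (C : ℝ) : Prop where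
  integrable : Integrable (fun y => logWeight y * |V y|) volume
  aesm : AEStronglyMeasurable V volume
  le : ∫ y, logWeight y * |V y| ≤ C
  integrable_negLog : ∀ x, Integrable (fun y => negLog ‖x - y‖ * (logWeight y * |V y|)) volume
  integral_negLog_le : ∀ x, ∫ y, negLog ‖x - y‖ * (logWeight y * |V y|) ≤ C
  integrable_negLog_sq : ∀ x,
    Integrable (fun y => negLog ‖x - y‖ ^ 2 * (logWeight y * |V y|)) volume
  integral_negLog_sq_le : ∀ x, ∫ y, negLog ‖x - y‖ ^ 2 * (logWeight y * |V y|) ≤ C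

theorem exists_isLogPotential {V : R4 → ℝ} {q : ℝ≥0∞} (hq : 1 < q)
    (hV1 : MemLp (fun x : R4 => logWeight x * V x) 1 volume)
    (hVq : MemLp (fun x : R4 => logWeight x * V x) q volume) : ∃ C, IsLogPotential V C := by
  have h1 := memLp_one_iff_integrable.1 hV1
  have habs : ∀ y, |logWeight y * V y| = logWeight y * |V y| := fun y => by
    rw [abs_mul, abs_of_pos (zero_lt_one.trans_le (one_le_logWeight y))]
  obtain ⟨C₁, hC₁⟩ := exists_integral_negLog_pow_mul_le hq h1 hVq one_ne_zero
  obtain ⟨C₂, hC₂⟩ := exists_integral_negLog_pow_mul_le hq h1 hVq two_ne_zero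
  simp only [habs, pow_one] at hC₁ hC₂
  refine ⟨max (∫ y, logWeight y * |V y|) (max C₁ C₂), ?_, ?_, le_max_left _ _, fun x => (hC₁ x).1,
    fun x => (hC₁ x).2.trans ((le_max_left _ _).trans (le_max_right _ _)), fun x => (hC₂ x).1,
    fun x => (hC₂ x).2.trans ((le_max_right _ _).trans (le_max_right _ _))⟩
  · exact h1.abs.congr (Eventually.of_forall habs)
  -- Measurability of `V` itself is recovered by dividing by the weight, which is at least `1`.
  · have h2 : AEStronglyMeasurable (fun y => (logWeight y)⁻¹ * (logWeight y * V y)) volume :=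
      measurable_logWeight.inv.aestronglyMeasurable.mul h1.1
    refine h2.congr (Eventually.of_forall fun y => ?_)
    exact inv_mul_cancel_left₀ (zero_lt_one.trans_le (one_le_logWeight y)).ne' _

/-- A majorant independent of `ε`, needed for the limit `ε → 0`. Adding `ε²` only weakens the
singularity, and the growth is controlled by `|y - z|² + 1 ≤ 2⟨z⟩²⟨y⟩²`. -/
theorem abs_log_norm_sub_sq_add_le {ε : ℝ} (hε : |ε| ≤ 1) {z y : R4} (h : y ≠ z) :
    |Real.log (‖y - z‖ ^ 2 + ε ^ 2)| ≤
      2 * (negLog ‖z - y‖ * logWeight y) + (1 + 2 * Real.log (japaneseBracket z) + 2) *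
        logWeight y := by
  have hp : 0 < ‖y - z‖ := norm_pos_iff.2 (sub_ne_zero.2 h)
  have hw := one_le_logWeight y
  have hn : negLog ‖z - y‖ ≤ negLog ‖z - y‖ * logWeight y :=
    le_mul_of_one_le_right (negLog_nonneg _) hw
  have hlz := Real.log_nonneg (one_le_japaneseBracket z)
  have hz := japaneseBracket_pos z
  have hy := japaneseBracket_pos y
  have hε2 : ε ^ 2 ≤ 1 := (sq_le_one_iff_abs_le_one ε).2 hε
  have hn0 := negLog_nonneg ‖z - y‖
  refine abs_le.2 ⟨?_, ?_⟩
  · have h1 : Real.log (‖y - z‖ ^ 2) ≤ Real.log (‖y - z‖ ^ 2 + ε ^ 2) :=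
      Real.log_le_log (by positivity) (by linarith [sq_nonneg ε])
    rw [Real.log_pow] at h1
    have h2 := neg_log_le_negLog ‖z - y‖
    rw [norm_sub_rev] at h2
    push_cast at h1
    rw [norm_sub_rev z y] at *
    nlinarith
  · have h1 : Real.log (‖y - z‖ ^ 2 + ε ^ 2) ≤
        Real.log (2 * japaneseBracket z ^ 2 * japaneseBracket y ^ 2) := by
      refine Real.log_le_log (by positivity) ?_
      rw [japaneseBracket_sq, japaneseBracket_sq]
      have h3 := norm_sub_le y z
      have h4 : ‖y - z‖ ^ 2 ≤ (‖y‖ + ‖z‖) ^ 2 := pow_le_pow_left₀ (norm_nonneg _) h3 2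
      nlinarith [sq_nonneg (‖y‖ - ‖z‖), mul_nonneg (sq_nonneg ‖y‖) (sq_nonneg ‖z‖)]
    rw [Real.log_mul (by positivity) (by positivity), Real.log_mul (by norm_num) (by positivity),
      Real.log_pow, Real.log_pow] at h1
    have h5 : Real.log (japaneseBracket y) ≤ logWeight y := by
      refine (Real.log_le_self hy.le).trans ((le_self_pow₀ (one_le_japaneseBracket y)
        (by norm_num : 3 ≠ 0)).trans (japaneseBracket_pow_three_le_logWeight y))
    have h6 : Real.log 2 ≤ 1 := Real.log_two_lt_d9.le.trans (by norm_num)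
    push_cast at h1
    nlinarith

/-! ### Logarithmic potentials and their limit as `ε → 0` -/

/-- The regularized logarithmic potential `∫ log (|y - z|² + ε²) v(y) dy`. -/
noncomputable def logPotential (v : R4 → ℂ) (ε : ℝ) (z : R4) : ℂ :=
  ∫ y, v y * (Real.log (‖y - z‖ ^ 2 + ε ^ 2) : ℝ)

section
variable {V : R4 → ℝ} {C M : ℝ} {v : R4 → ℂ}

/-- A majorant of `log (|y - z|² + ε²) v(y)`, uniform in `|ε| ≤ 1`. -/
noncomputable def logMajorant (V : R4 → ℝ) (M : ℝ) (z y : R4) : ℝ :=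
  M * (2 * (negLog ‖z - y‖ * (logWeight y * |V y|)) +
    (1 + 2 * Real.log (japaneseBracket z) + 2) * (logWeight y * |V y|))

theorem IsLogPotential.integrable_logMajorant (hV : IsLogPotential V C) (M : ℝ) (z : R4) :
    Integrable (logMajorant V M z) volume :=
  (((hV.integrable_negLog z).const_mul 2).add (hV.integrable.const_mul _)).const_mul M

theorem IsLogPotential.integral_logMajorant_le (hV : IsLogPotential V C) (hM : 0 ≤ M) (z : R4) :
    ∫ y, logMajorant V M z y ≤ M * (C * (5 + 2 * Real.log (japaneseBracket z))) := by
  have hlz := Real.log_nonneg (one_le_japaneseBracket z)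
  unfold logMajorant
  rw [integral_const_mul, integral_add ((hV.integrable_negLog z).const_mul 2)
    (hV.integrable.const_mul _), integral_const_mul, integral_const_mul]
  refine mul_le_mul_of_nonneg_left ?_ hM
  nlinarith [hV.le, hV.integral_negLog_le z]

theorem norm_mul_log_le_logMajorant (hv : ∀ y, ‖v y‖ ≤ M * |V y|) {ε : ℝ}
    (hε : |ε| ≤ 1) (z : R4) :
    ∀ᵐ y, ‖v y * (Real.log (‖y - z‖ ^ 2 + ε ^ 2) : ℝ)‖ ≤ logMajorant V M z y := by
  have h0 : ∀ᵐ y : R4, y ≠ z := by simp [ae_iff]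
  filter_upwards [h0] with y hy
  rw [norm_mul, Complex.norm_real]
  refine (mul_le_mul (hv y) (abs_log_norm_sub_sq_add_le hε hy) (abs_nonneg _)
    ((norm_nonneg _).trans (hv y))).trans (le_of_eq ?_)
  rw [logMajorant]
  ring

theorem aestronglyMeasurable_logPotential_integrand (hm : AEStronglyMeasurable v volume) (ε : ℝ) :
    AEStronglyMeasurable (fun p : R4 × R4 => v p.2 * (Real.log (‖p.2 - p.1‖ ^ 2 + ε ^ 2) : ℝ))
      (volume.prod volume) := by
  refine hm.comp_snd.mul (Measurable.aestronglyMeasurable ?_)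
  fun_prop

theorem IsLogPotential.integrable_logPotential_integrand (hV : IsLogPotential V C)
    (hm : AEStronglyMeasurable v volume) (hv : ∀ y, ‖v y‖ ≤ M * |V y|) {ε : ℝ}
    (hε : |ε| ≤ 1) (z : R4) :
    Integrable (fun y => v y * (Real.log (‖y - z‖ ^ 2 + ε ^ 2) : ℝ)) volume := by
  refine (hV.integrable_logMajorant M z).mono' ?_ (norm_mul_log_le_logMajorant hv hε z)
  refine hm.mul (Measurable.aestronglyMeasurable ?_)
  fun_prop

theorem IsLogPotential.norm_logPotential_le (hV : IsLogPotential V C) (hM : 0 ≤ M)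
    (hv : ∀ y, ‖v y‖ ≤ M * |V y|) {ε : ℝ} (hε : |ε| ≤ 1) (z : R4) :
    ‖logPotential v ε z‖ ≤ M * (C * (5 + 2 * Real.log (japaneseBracket z))) :=
  (norm_integral_le_of_norm_le (hV.integrable_logMajorant M z)
    (norm_mul_log_le_logMajorant hv hε z)).trans (hV.integral_logMajorant_le hM z)

theorem aestronglyMeasurable_logPotential (hm : AEStronglyMeasurable v volume) (ε : ℝ) :
    AEStronglyMeasurable (logPotential v ε) volume :=
  (aestronglyMeasurable_logPotential_integrand hm ε).integral_prod_right'

theorem IsLogPotential.tendsto_logPotential (hV : IsLogPotential V C)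
    (hm : AEStronglyMeasurable v volume) (hv : ∀ y, ‖v y‖ ≤ M * |V y|) (z : R4) :
    Tendsto (fun ε => logPotential v ε z) (nhdsWithin 0 (Set.Ioi 0))
      (nhds (logPotential v 0 z)) := by
  have hev : ∀ᶠ ε : ℝ in nhdsWithin 0 (Set.Ioi 0), |ε| ≤ 1 := by
    filter_upwards [Ioo_mem_nhdsGT (zero_lt_one' ℝ)] with ε hε
    rw [abs_of_pos hε.1]
    exact hε.2.le
  refine tendsto_integral_filter_of_dominated_convergence (logMajorant V M z) ?_ ?_
    (hV.integrable_logMajorant M z) ?_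
  · filter_upwards [hev] with ε hε
    exact (hV.integrable_logPotential_integrand hm hv hε z).1
  · filter_upwards [hev] with ε hε using norm_mul_log_le_logMajorant hv hε z
  · have h0 : ∀ᵐ y : R4, y ≠ z := by simp [ae_iff]
    filter_upwards [h0] with y hy
    refine Tendsto.const_mul _ ((Complex.continuous_ofReal.tendsto _).comp ?_)
    have hc : ContinuousAt (fun ε : ℝ => Real.log (‖y - z‖ ^ 2 + ε ^ 2)) 0 := by
      refine ContinuousAt.log (by fun_prop) ?_
      have : 0 < ‖y - z‖ := norm_pos_iff.2 (sub_ne_zero.2 hy)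
      positivity
    exact hc.tendsto.mono_left nhdsWithin_le_nhds

theorem continuous_log_japaneseBracket : Continuous fun z : R4 => Real.log (japaneseBracket z) :=
  continuous_japaneseBracket.log fun z => (japaneseBracket_pos z).ne'

theorem IsLogPotential.tendsto_integral_mul_logPotential (hV : IsLogPotential V C) (hM : 0 ≤ M)
    (hm : AEStronglyMeasurable v volume) (hv : ∀ y, ‖v y‖ ≤ M * |V y|) {g : R4 → ℝ}
    (hg : Continuous g) (hgc : HasCompactSupport g) :
    Tendsto (fun ε => ∫ z, g z * logPotential v ε z) (nhdsWithin 0 (Set.Ioi 0))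
      (nhds (∫ z, g z * logPotential v 0 z)) := by
  have hev : ∀ᶠ ε : ℝ in nhdsWithin 0 (Set.Ioi 0), |ε| ≤ 1 := by
    filter_upwards [Ioo_mem_nhdsGT (zero_lt_one' ℝ)] with ε hε
    rw [abs_of_pos hε.1]
    exact hε.2.le
  refine tendsto_integral_filter_of_dominated_convergence
    (fun z => |g z| * (M * (C * (5 + 2 * Real.log (japaneseBracket z))))) ?_ ?_ ?_ ?_
  · refine Eventually.of_forall fun ε => ?_
    exact (Complex.continuous_ofReal.comp hg).aestronglyMeasurable.mul
      (aestronglyMeasurable_logPotential hm ε)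
  · filter_upwards [hev] with ε hε
    refine Eventually.of_forall fun z => ?_
    rw [norm_mul, Complex.norm_real]
    exact mul_le_mul_of_nonneg_left (hV.norm_logPotential_le hM hv hε z) (norm_nonneg _)
  · refine Continuous.integrable_of_hasCompactSupport ?_ ?_
    · have := continuous_log_japaneseBracket
      fun_prop
    · exact HasCompactSupport.mul_right hgc.norm
  · exact Eventually.of_forall fun z => (hV.tendsto_logPotential hm hv z).const_mul _

theorem IsLogPotential.locallyIntegrable_logPotential (hV : IsLogPotential V C) (hM : 0 ≤ M)
    (hm : AEStronglyMeasurable v volume) (hv : ∀ y, ‖v y‖ ≤ M * |V y|) :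
    LocallyIntegrable (logPotential v 0) volume := by
  have h : Continuous fun z : R4 => M * (C * (5 + 2 * Real.log (japaneseBracket z))) := by
    have := continuous_log_japaneseBracket
    fun_prop
  refine h.locallyIntegrable.mono (aestronglyMeasurable_logPotential hm 0)
    (Eventually.of_forall fun z => ?_)
  exact (hV.norm_logPotential_le hM hv (by simp) z).trans (le_abs_self _)

end

/-! ### Mollification by the bump and the representation formula -/

theorem biharmonicBump_smul {ε : ℝ} (hε : 0 < ε) (y : R4) :
    ε ^ 4 * biharmonicBump ε (ε • y) = biharmonicBump 1 y := by
  rw [biharmonicBump, biharmonicBump, norm_smul, Real.norm_of_nonneg hε.le,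
    show (ε * ‖y‖) ^ 2 + ε ^ 2 = ε ^ 2 * (‖y‖ ^ 2 + 1 ^ 2) by ring]
  have : ‖y‖ ^ 2 + 1 ^ 2 ≠ 0 := by positivity
  field_simp

theorem integral_mul_biharmonicBump_eq {ε : ℝ} (hε : 0 < ε) (u : R4 → ℂ) (z : R4) :
    ∫ x, u x * biharmonicBump ε (x - z) = ∫ y, u (z + ε • y) * biharmonicBump 1 y := by
  have h1 : ∫ x, u x * biharmonicBump ε (x - z) = ∫ x, u (z + x) * biharmonicBump ε x := by
    rw [← integral_add_left_eq_self _ z]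
    simp
  have h2 := Measure.integral_comp_smul_of_nonneg (volume : Measure R4)
    (fun x => u (z + x) * biharmonicBump ε x) ε (hR := hε.le)
  rw [h1]
  have h3 : ∀ y : R4, u (z + ε • y) * biharmonicBump 1 y =
      (ε ^ 4 : ℝ) • (u (z + ε • y) * biharmonicBump ε (ε • y)) := by
    intro y
    rw [← biharmonicBump_smul hε y, Complex.real_smul]
    push_cast
    ring
  simp_rw [h3]
  rw [integral_smul, h2, finrank_euclideanSpace_fin, smul_inv_smul₀ (pow_pos hε 4).ne']

/-- Fubini and a translation move the mollification from the merely bounded `u` to the continuous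
test function `g`, where the limit `ε → 0` is pointwise. -/
theorem integral_mul_integral_biharmonicBump {u : R4 → ℂ} {M : ℝ} (hu : StronglyMeasurable u)
    (hM : ∀ x, ‖u x‖ ≤ M) {g : R4 → ℝ} (hg : Continuous g) (hgc : HasCompactSupport g)
    {ε : ℝ} (hε : 0 < ε) :
    ∫ z, g z * ∫ x, u x * biharmonicBump ε (x - z) =
      ∫ y, (∫ z, g (z - ε • y) * u z) * biharmonicBump 1 y := by
  have hgi : Integrable g volume := hg.integrable_of_hasCompactSupport hgc
  have hi : Integrable (Function.uncurry fun z y : R4 =>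
      (g z : ℂ) * (u (z + ε • y) * biharmonicBump 1 y)) (volume.prod volume) := by
    have h1 : Integrable (fun p : R4 × R4 => ((g p.1 : ℂ) * (biharmonicBump 1 p.2 : ℂ)))
        (volume.prod volume) := hgi.ofReal.mul_prod (integrable_biharmonicBump one_pos).ofReal
    have h2 : StronglyMeasurable fun p : R4 × R4 => u (p.1 + ε • p.2) :=
      hu.comp_measurable (by fun_prop)
    refine (h1.bdd_mul (c := M) h2.aestronglyMeasurable
      (Eventually.of_forall fun p => hM _)).congr (Eventually.of_forall fun p => ?_)
    simp only [Function.uncurry]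
    ring
  calc ∫ z, g z * ∫ x, u x * biharmonicBump ε (x - z)
      = ∫ z, ∫ y, (g z : ℂ) * (u (z + ε • y) * biharmonicBump 1 y) := by
        simp_rw [integral_mul_biharmonicBump_eq hε, integral_const_mul]
    _ = ∫ y, ∫ z, (g z : ℂ) * (u (z + ε • y) * biharmonicBump 1 y) := integral_integral_swap hi
    _ = _ := by
        congr 1
        funext y
        rw [← integral_sub_right_eq_self _ (ε • y), ← integral_mul_const]
        simp only [sub_add_cancel, mul_assoc]

theorem tendsto_integral_comp_sub_smul_mul {u : R4 → ℂ} {M : ℝ} (hu : StronglyMeasurable u)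
    (hM : ∀ x, ‖u x‖ ≤ M) {g : R4 → ℝ} (hg : Continuous g) (hgc : HasCompactSupport g) (y : R4) :
    Tendsto (fun ε : ℝ => ∫ z, g (z - ε • y) * u z) (nhdsWithin 0 (Set.Ioi 0))
      (nhds (∫ z, g z * u z)) := by
  obtain ⟨B, hB⟩ := hg.bounded_above_of_compact_support hgc
  obtain ⟨r, hr⟩ := hgc.isCompact.isBounded.subset_closedBall 0
  refine tendsto_integral_filter_of_dominated_convergence
    -- For `0 < ε < 1` all translates of `g` by `ε y` are supported in this one ball.
    ((Metric.closedBall (0 : R4) (r + ‖y‖)).indicator fun _ => B * M) ?_ ?_ ?_ ?_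
  · refine Eventually.of_forall fun ε => ?_
    exact (Complex.continuous_ofReal.comp (hg.comp (by fun_prop))).aestronglyMeasurable.mul
      hu.aestronglyMeasurable
  · filter_upwards [Ioo_mem_nhdsGT (zero_lt_one' ℝ)] with ε hε
    refine Eventually.of_forall fun z => ?_
    rw [norm_mul, Complex.norm_real]
    by_cases hz : z ∈ Metric.closedBall (0 : R4) (r + ‖y‖)
    · rw [Set.indicator_of_mem hz]
      exact mul_le_mul (hB _) (hM _) (norm_nonneg _) ((norm_nonneg _).trans (hB z))
    · have h0 : g (z - ε • y) = 0 := by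
        refine image_eq_zero_of_notMem_tsupport fun h => hz ?_
        have h1 := hr h
        rw [mem_closedBall_zero_iff] at h1 ⊢
        have h2 : ‖ε • y‖ ≤ ‖y‖ := by
          rw [norm_smul, Real.norm_of_nonneg hε.1.le]
          exact mul_le_of_le_one_left (norm_nonneg _) hε.2.le
        have h3 := norm_add_le (z - ε • y) (ε • y)
        rw [sub_add_cancel] at h3
        linarith
      rw [Set.indicator_of_notMem hz, h0, norm_zero, zero_mul]
  · exact (integrable_indicator_iff Metric.isClosed_closedBall.measurableSet).2
      (integrableOn_const measure_closedBall_lt_top.ne)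
  · refine Eventually.of_forall fun z => Tendsto.mul_const _ ?_
    have hc : Continuous fun ε : ℝ => (g (z - ε • y) : ℂ) :=
      Complex.continuous_ofReal.comp (hg.comp (by fun_prop))
    simpa using (hc.tendsto 0).mono_left nhdsWithin_le_nhds

theorem tendsto_integral_mul_integral_biharmonicBump {u : R4 → ℂ} {M : ℝ}
    (hu : StronglyMeasurable u) (hM : ∀ x, ‖u x‖ ≤ M) {g : R4 → ℝ} (hg : Continuous g)
    (hgc : HasCompactSupport g) :
    Tendsto (fun ε : ℝ => ∫ z, g z * ∫ x, u x * biharmonicBump ε (x - z))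
      (nhdsWithin 0 (Set.Ioi 0)) (nhds ((∫ y, biharmonicBump 1 y : ℝ) * ∫ z, g z * u z)) := by
  have hb := (integrable_biharmonicBump one_pos)
  have hgi : Integrable g volume := hg.integrable_of_hasCompactSupport hgc
  have hlim : Tendsto (fun ε : ℝ => ∫ y, (∫ z, g (z - ε • y) * u z) * biharmonicBump 1 y)
      (nhdsWithin 0 (Set.Ioi 0)) (nhds (∫ y, (∫ z, g z * u z) * (biharmonicBump 1 y : ℂ))) := by
    refine tendsto_integral_filter_of_dominated_convergence
      (fun y => ((∫ z, |g z|) * M) * |biharmonicBump 1 y|) ?_ ?_ (hb.abs.const_mul _) ?_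
    · refine Eventually.of_forall fun ε => ?_
      refine StronglyMeasurable.aestronglyMeasurable ?_
      refine StronglyMeasurable.mul ?_
        (Complex.continuous_ofReal.comp (continuous_biharmonicBump one_pos)).stronglyMeasurable
      have h : StronglyMeasurable fun p : R4 × R4 => (g (p.2 - ε • p.1) : ℂ) * u p.2 :=
        (Complex.continuous_ofReal.comp (hg.comp (by fun_prop))).stronglyMeasurable.mul
          (hu.comp_measurable measurable_snd)
      exact h.integral_prod_right'
    · refine Eventually.of_forall fun ε => Eventually.of_forall fun y => ?_
      rw [norm_mul, Complex.norm_real, Real.norm_eq_abs]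
      refine mul_le_mul_of_nonneg_right ?_ (abs_nonneg _)
      rw [← integral_sub_right_eq_self (fun z => |g z|) (ε • y), ← integral_mul_const]
      refine norm_integral_le_of_norm_le ((hgi.comp_sub_right (ε • y)).abs.mul_const M)
        (Eventually.of_forall fun z => ?_)
      rw [norm_mul, Complex.norm_real]
      exact mul_le_mul_of_nonneg_left (hM _) (norm_nonneg _)
    · exact Eventually.of_forall fun y =>
        (tendsto_integral_comp_sub_smul_mul hu hM hg hgc y).mul_const _
  rw [integral_const_mul, integral_complex_ofReal, mul_comm] at hlim
  refine hlim.congr' ?_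
  filter_upwards [self_mem_nhdsWithin] with ε hε
  exact (integral_mul_integral_biharmonicBump hu hM hg hgc hε).symm

/-- Bounded distributional solutions are logarithmic potentials up to a constant. -/
theorem IsLogPotential.exists_eq_const_add_logPotential {V : R4 → ℝ} {C M : ℝ} {u : R4 → ℂ}
    (hV : IsLogPotential V C) (hu : StronglyMeasurable u) (hM : ∀ x, ‖u x‖ ≤ M)
    (hVu : IsDistribSolution V u) :
    ∃ c : ℂ, ∀ᵐ z, (∫ y, biharmonicBump 1 y : ℝ) * u z =
      c + logPotential (fun y => V y * u y) 0 z := by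
  set v : R4 → ℂ := fun y => V y * u y with hv_def
  set κ : ℝ := ∫ y, biharmonicBump 1 y
  have hM0 : 0 ≤ M := (norm_nonneg _).trans (hM 0)
  have hvm : AEStronglyMeasurable v volume :=
    (Complex.continuous_ofReal.comp_aestronglyMeasurable hV.aesm).mul hu.aestronglyMeasurable
  have hv : ∀ y, ‖v y‖ ≤ M * |V y| := by
    intro y
    rw [hv_def, norm_mul, Complex.norm_real, mul_comm]
    exact mul_le_mul_of_nonneg_right (hM y) (abs_nonneg _)
  have hvi : Integrable v volume := by
    refine (hV.integrable.const_mul M).mono' hvm (Eventually.of_forall fun y => (hv y).trans ?_)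
    exact mul_le_mul_of_nonneg_left
      (le_mul_of_one_le_left (abs_nonneg _) (one_le_logWeight y)) hM0
  let S : ℝ → R4 → ℂ := fun ε z => ∫ x, u x * biharmonicBump ε (x - z)
  have hS : ∀ ε : ℝ, 0 < ε → ε ≤ 1 → ∀ z, S ε z = (S ε 0 - logPotential v ε 0) +
      logPotential v ε z := by
    intro ε h0 h1 z
    have hε : |ε| ≤ 1 := by rwa [abs_of_pos h0]
    have h := integral_mul_biharmonicBump_sub hu.aestronglyMeasurable (Eventually.of_forall hM)
      hVu hvi h0 z 0
    have hsub : ∫ x, V x * u x * ((Real.log (‖x - z‖ ^ 2 + ε ^ 2) -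
        Real.log (‖x - 0‖ ^ 2 + ε ^ 2) : ℝ) : ℂ) = logPotential v ε z - logPotential v ε 0 := by
      rw [logPotential, logPotential, ← integral_sub
        (hV.integrable_logPotential_integrand hvm hv hε z)
        (hV.integrable_logPotential_integrand hvm hv hε 0)]
      congr 1
      funext x
      rw [hv_def]
      push_cast
      ring
    rw [hsub] at h
    linear_combination h
  -- No pointwise limit of `S ε 0` is available, so convergence of this constant is obtained by
  -- testing against a function of integral one.
  let c : ℝ → ℂ := fun ε => S ε 0 - logPotential v ε 0
  have hc : ∀ g : R4 → ℝ, Continuous g → HasCompactSupport g →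
      Tendsto (fun ε => c ε * ∫ z, (g z : ℂ)) (nhdsWithin 0 (Set.Ioi 0))
        (nhds (κ * (∫ z, g z * u z) - ∫ z, g z * logPotential v 0 z)) := by
    intro g hg hgc
    have hgi : Integrable (fun z => (g z : ℂ)) volume :=
      (hg.integrable_of_hasCompactSupport hgc).ofReal
    refine ((tendsto_integral_mul_integral_biharmonicBump hu hM hg hgc).sub
      (hV.tendsto_integral_mul_logPotential hM0 hvm hv hg hgc)).congr' ?_
    filter_upwards [Ioo_mem_nhdsGT (zero_lt_one' ℝ)] with ε hε
    have hε' : |ε| ≤ 1 := by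
      rw [abs_of_pos hε.1]
      exact hε.2.le
    have e1 : ∀ z, (g z : ℂ) * S ε z = c ε * g z + g z * logPotential v ε z := by
      intro z
      rw [hS ε hε.1 hε.2.le z]
      ring
    have e2 : Integrable (fun z => (g z : ℂ) * logPotential v ε z) volume := by
      have h1 : Continuous fun z : R4 => |g z| * (M * (C * (5 + 2 * Real.log (japaneseBracket z)))) := by
        have := continuous_log_japaneseBracket
        fun_prop
      refine (h1.integrable_of_hasCompactSupport (HasCompactSupport.mul_right hgc.norm)).mono'
        ((Complex.continuous_ofReal.comp hg).aestronglyMeasurable.mul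
          (aestronglyMeasurable_logPotential hvm ε)) (Eventually.of_forall fun z => ?_)
      rw [norm_mul, Complex.norm_real]
      exact mul_le_mul_of_nonneg_left (hV.norm_logPotential_le hM0 hv hε' z) (norm_nonneg _)
    change (∫ z, (g z : ℂ) * S ε z) - _ = _
    simp_rw [e1]
    rw [integral_add (hgi.const_mul _) e2, integral_const_mul, add_sub_cancel_right]
  let f₀ : ContDiffBump (0 : R4) := ⟨1, 2, one_pos, one_lt_two⟩
  let g₀ : R4 → ℝ := f₀.normed volume
  have hg₀ : ∫ z, (g₀ z : ℂ) = 1 := by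
    rw [integral_complex_ofReal, f₀.integral_normed, Complex.ofReal_one]
  have hc₀ := hc g₀ f₀.continuous_normed f₀.hasCompactSupport_normed
  rw [hg₀] at hc₀
  simp only [mul_one] at hc₀
  set c₀ : ℂ := κ * (∫ z, g₀ z * u z) - ∫ z, g₀ z * logPotential v 0 z
  have huloc : LocallyIntegrable u volume := by
    refine (locallyIntegrable_const M).mono hu.aestronglyMeasurable
      (Eventually.of_forall fun z => ?_)
    exact (hM z).trans (le_abs_self _)
  have hTloc := hV.locallyIntegrable_logPotential hM0 hvm hv
  refine ⟨c₀, ae_eq_of_integral_contDiff_smul_eq (huloc.smul (κ : ℂ))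
    ((locallyIntegrable_const c₀).add hTloc) fun g hg hgc => ?_⟩
  have hgi : Integrable (fun z => (g z : ℂ)) volume :=
    (hg.continuous.integrable_of_hasCompactSupport hgc).ofReal
  -- Both limits compute `lim c(ε) ∫ g`, which identifies `κ u` with `c₀` plus the potential as
  -- distributions.
  have h := tendsto_nhds_unique (hc g hg.continuous hgc) (hc₀.mul_const _)
  have e2 : Integrable (fun z => (g z : ℂ) * logPotential v 0 z) volume :=
    hTloc.integrable_smul_left_of_hasCompactSupport (Complex.continuous_ofReal.comp hg.continuous)
      (hgc.comp_left Complex.ofReal_zero)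
  simp only [Complex.real_smul, mul_add]
  rw [integral_add (hgi.mul_const _) e2, integral_mul_const]
  have e3 : ∫ z, (g z : ℂ) * (κ * u z) = κ * ∫ z, g z * u z := by
    rw [← integral_const_mul]
    congr 1
    funext z
    ring
  rw [e3]
  linear_combination h

/-! ### The normalized kernel, the condition `∫ V u = 0` and the sup bound -/

/-- The logarithmic kernel, normalized to be bounded as `x → ∞`. -/
noncomputable def logKernel (x y : R4) : ℝ := Real.log ‖x - y‖ - Real.log (japaneseBracket x)

theorem measurable_logKernel (x : R4) : Measurable (logKernel x) := by
  unfold logKernel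
  fun_prop

theorem logKernel_sq_le (x y : R4) :
    logKernel x y ^ 2 ≤ 6 * logWeight y + 3 * (negLog ‖x - y‖ ^ 2 * logWeight y) := by
  have h1 := abs_log_norm_sub_sub_log_japaneseBracket_le x y
  have hy := one_le_japaneseBracket y
  have h2 : Real.log (japaneseBracket y) ≤ japaneseBracket y := Real.log_le_self (by linarith)
  have h3 : Real.log 2 ≤ 1 := Real.log_two_lt_d9.le.trans (by norm_num)
  have hn := negLog_nonneg ‖x - y‖
  have hw := one_le_logWeight y
  have h4 : japaneseBracket y ^ 2 ≤ logWeight y :=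
    (pow_le_pow_right₀ hy (by norm_num : 2 ≤ 3)).trans (japaneseBracket_pow_three_le_logWeight y)
  have h5 : |logKernel x y| ≤ 1 + japaneseBracket y + negLog ‖x - y‖ := by
    unfold logKernel
    linarith
  have h6 : logKernel x y ^ 2 ≤ (1 + japaneseBracket y + negLog ‖x - y‖) ^ 2 := by
    rw [← sq_abs]
    exact pow_le_pow_left₀ (abs_nonneg _) h5 2
  have h7 : negLog ‖x - y‖ ^ 2 ≤ negLog ‖x - y‖ ^ 2 * logWeight y :=
    le_mul_of_one_le_right (sq_nonneg _) hw
  nlinarith [sq_nonneg (1 - japaneseBracket y), sq_nonneg (1 - negLog ‖x - y‖),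
    sq_nonneg (japaneseBracket y - negLog ‖x - y‖)]

section
variable {V : R4 → ℝ} {C M : ℝ} {u : R4 → ℂ}

theorem IsLogPotential.integrable_logKernel_sq (hV : IsLogPotential V C) (x : R4) :
    Integrable (fun y => logKernel x y ^ 2 * |V y|) volume ∧
      ∫ y, logKernel x y ^ 2 * |V y| ≤ 9 * C := by
  have hi : Integrable (fun y => 6 * (logWeight y * |V y|) +
      3 * (negLog ‖x - y‖ ^ 2 * (logWeight y * |V y|))) volume :=
    (hV.integrable.const_mul 6).add ((hV.integrable_negLog_sq x).const_mul 3)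
  have hle : ∀ y, logKernel x y ^ 2 * |V y| ≤ 6 * (logWeight y * |V y|) +
      3 * (negLog ‖x - y‖ ^ 2 * (logWeight y * |V y|)) := fun y =>
    (mul_le_mul_of_nonneg_right (logKernel_sq_le x y) (abs_nonneg _)).trans (le_of_eq (by ring))
  have hi' : Integrable (fun y => logKernel x y ^ 2 * |V y|) volume := by
    refine hi.mono' (((measurable_logKernel x).pow_const 2).aestronglyMeasurable.mul
      (continuous_abs.comp_aestronglyMeasurable hV.aesm)) (Eventually.of_forall fun y => ?_)
    rw [Real.norm_of_nonneg (by positivity)]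
    exact hle y
  refine ⟨hi', (integral_mono hi' hi hle).trans ?_⟩
  rw [integral_add (hV.integrable.const_mul 6) ((hV.integrable_negLog_sq x).const_mul 3),
    integral_const_mul, integral_const_mul]
  linarith [hV.le, hV.integral_negLog_sq_le x]

theorem IsLogPotential.integrable_abs (hV : IsLogPotential V C) :
    Integrable (fun y => |V y|) volume := by
  refine hV.integrable.mono' (continuous_abs.comp_aestronglyMeasurable hV.aesm)
    (Eventually.of_forall fun y => ?_)
  rw [Real.norm_eq_abs, abs_abs]
  exact le_mul_of_one_le_left (abs_nonneg _) (one_le_logWeight y)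

theorem IsLogPotential.aestronglyMeasurable_mul (hV : IsLogPotential V C)
    (hu : StronglyMeasurable u) : AEStronglyMeasurable (fun y => (V y : ℂ) * u y) volume :=
  (Complex.continuous_ofReal.comp_aestronglyMeasurable hV.aesm).mul hu.aestronglyMeasurable

theorem norm_ofReal_mul_le (hM : ∀ x, ‖u x‖ ≤ M) (y : R4) : ‖(V y : ℂ) * u y‖ ≤ M * |V y| := by
  rw [norm_mul, Complex.norm_real, mul_comm]
  exact mul_le_mul_of_nonneg_right (hM y) (abs_nonneg _)

theorem IsLogPotential.integrable_mul (hV : IsLogPotential V C) (hu : StronglyMeasurable u)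
    (hM : ∀ x, ‖u x‖ ≤ M) : Integrable (fun y => (V y : ℂ) * u y) volume :=
  (hV.integrable_abs.const_mul M).mono' (hV.aestronglyMeasurable_mul hu)
    (Eventually.of_forall (norm_ofReal_mul_le hM))

theorem IsLogPotential.integrable_abs_mul_sq (hV : IsLogPotential V C) (hu : StronglyMeasurable u)
    (hM : ∀ x, ‖u x‖ ≤ M) : Integrable (fun y => |V y| * ‖u y‖ ^ 2) volume := by
  refine (hV.integrable_abs.mul_const (M ^ 2)).mono'
    ((continuous_abs.comp_aestronglyMeasurable hV.aesm).mul
      (hu.norm.pow 2).aestronglyMeasurable) (Eventually.of_forall fun y => ?_)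
  rw [Real.norm_of_nonneg (by positivity)]
  exact mul_le_mul_of_nonneg_left (pow_le_pow_left₀ (norm_nonneg _) (hM y) 2) (abs_nonneg _)

/-- Weighted arithmetic-geometric mean bound for the potential of `V u`. -/
theorem IsLogPotential.integrable_mul_logKernel (hV : IsLogPotential V C)
    (hu : StronglyMeasurable u) (hM : ∀ x, ‖u x‖ ≤ M) (x : R4) :
    Integrable (fun y => (V y : ℂ) * u y * logKernel x y) volume ∧
      ∀ t : ℝ, 0 < t → 2 * ‖∫ y, (V y : ℂ) * u y * logKernel x y‖ ≤
        9 * C * t + (∫ y, |V y| * ‖u y‖ ^ 2) / t := by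
  obtain ⟨hK, hKle⟩ := hV.integrable_logKernel_sq x
  have hQ := hV.integrable_abs_mul_sq hu hM
  have hi (t : ℝ) : Integrable (fun y => t / 2 * (logKernel x y ^ 2 * |V y|) +
      (2 * t)⁻¹ * (|V y| * ‖u y‖ ^ 2)) volume := (hK.const_mul _).add (hQ.const_mul _)
  -- Cauchy–Schwarz in the form `ab ≤ (t a² + b²/t)/2` with a free parameter, which avoids square
  -- roots.
  have hle : ∀ t : ℝ, 0 < t → ∀ y, ‖(V y : ℂ) * u y * logKernel x y‖ ≤
      t / 2 * (logKernel x y ^ 2 * |V y|) + (2 * t)⁻¹ * (|V y| * ‖u y‖ ^ 2) := by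
    intro t ht y
    rw [norm_mul, norm_mul, Complex.norm_real, Complex.norm_real, Real.norm_eq_abs,
      Real.norm_eq_abs, ← sq_abs (logKernel x y)]
    have h1 : |logKernel x y| * ‖u y‖ ≤ t / 2 * |logKernel x y| ^ 2 + (2 * t)⁻¹ * ‖u y‖ ^ 2 := by
      have h2 : t / 2 * |logKernel x y| ^ 2 + (2 * t)⁻¹ * ‖u y‖ ^ 2 - |logKernel x y| * ‖u y‖ =
          (2 * t)⁻¹ * (t * |logKernel x y| - ‖u y‖) ^ 2 := by
        field_simp
        ring
      have h3 : 0 ≤ (2 * t)⁻¹ * (t * |logKernel x y| - ‖u y‖) ^ 2 := by positivity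
      linarith
    nlinarith [mul_le_mul_of_nonneg_left h1 (abs_nonneg (V y))]
  refine ⟨(hi 1).mono' ((hV.aestronglyMeasurable_mul hu).mul
    (Complex.continuous_ofReal.comp_aestronglyMeasurable
      (measurable_logKernel x).aestronglyMeasurable))
    (Eventually.of_forall (hle 1 one_pos)), fun t ht => ?_⟩
  have h := norm_integral_le_of_norm_le (hi t) (Eventually.of_forall (hle t ht))
  rw [integral_add (hK.const_mul _) (hQ.const_mul _), integral_const_mul, integral_const_mul] at h
  have e : (2 * t)⁻¹ * ∫ y, |V y| * ‖u y‖ ^ 2 = (∫ y, |V y| * ‖u y‖ ^ 2) / t / 2 := by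
    field_simp
  rw [e] at h
  nlinarith [mul_le_mul_of_nonneg_left hKle ht.le]

theorem IsLogPotential.logPotential_eq (hV : IsLogPotential V C) (hu : StronglyMeasurable u)
    (hM : ∀ x, ‖u x‖ ≤ M) (z : R4) :
    logPotential (fun y => (V y : ℂ) * u y) 0 z =
      2 * Real.log (japaneseBracket z) * (∫ y, (V y : ℂ) * u y) +
        2 * ∫ y, (V y : ℂ) * u y * logKernel z y := by
  rw [logPotential, ← integral_const_mul, ← integral_const_mul,
    ← integral_add ((hV.integrable_mul hu hM).const_mul _)
      ((hV.integrable_mul_logKernel hu hM z).1.const_mul _)]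
  congr 1
  funext y
  rw [logKernel, norm_sub_rev y z]
  simp only [ne_eq, OfNat.ofNat_ne_zero, not_false_eq_true, zero_pow, add_zero, Real.log_pow]
  push_cast
  ring

/-- Bounded solutions satisfy `∫ V u = 0`. -/
theorem IsLogPotential.integral_eq_zero (hV : IsLogPotential V C) (hu : StronglyMeasurable u)
    (hM : ∀ x, ‖u x‖ ≤ M) {κ : ℝ} {c : ℂ}
    (h : ∀ᵐ z, κ * u z = c + logPotential (fun y => (V y : ℂ) * u y) 0 z) :
    ∫ y, (V y : ℂ) * u y = 0 := by
  by_contra hm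
  have hm' : 0 < ‖∫ y, (V y : ℂ) * u y‖ := norm_pos_iff.2 hm
  set m := ∫ y, (V y : ℂ) * u y
  set B := (|κ| * M + ‖c‖ + (9 * C * 1 + (∫ y, |V y| * ‖u y‖ ^ 2) / 1)) / (2 * ‖m‖) with hB
  -- If `m ≠ 0`, all other terms of the representation are bounded, so `log⟨z⟩` would be bounded
  -- almost everywhere; this fails on a nonempty open set.
  have hae : ∀ᵐ z : R4, Real.log (japaneseBracket z) ≤ B := by
    filter_upwards [h] with z hz
    rw [hV.logPotential_eq hu hM] at hz
    have h1 := (hV.integrable_mul_logKernel hu hM z).2 1 one_pos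
    have hl := Real.log_nonneg (one_le_japaneseBracket z)
    have h2 : 2 * Real.log (japaneseBracket z) * m = κ * u z - c -
        2 * ∫ y, (V y : ℂ) * u y * logKernel z y := by
      rw [hz]
      ring
    have h3 := congrArg norm h2
    rw [norm_mul, norm_mul, Complex.norm_real, Real.norm_of_nonneg hl, Complex.norm_ofNat] at h3
    have h4 := norm_sub_le (κ * u z - c) (2 * ∫ y, (V y : ℂ) * u y * logKernel z y)
    have h5 := norm_sub_le (κ * u z) c
    rw [norm_mul, Complex.norm_ofNat] at h4
    rw [norm_mul, Complex.norm_real, Real.norm_eq_abs] at h5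
    have h6 := mul_le_mul_of_nonneg_left (hM z) (abs_nonneg κ)
    rw [hB, le_div_iff₀ (by positivity)]
    linarith
  obtain ⟨z, hz⟩ := NormedSpace.exists_lt_norm ℝ R4 (Real.exp B)
  have hopen : IsOpen {z : R4 | B < Real.log (japaneseBracket z)} :=
    isOpen_lt continuous_const continuous_log_japaneseBracket
  have hne : {z : R4 | B < Real.log (japaneseBracket z)}.Nonempty :=
    ⟨z, (Real.lt_log_iff_exp_lt (japaneseBracket_pos z)).2
      (hz.trans_le (norm_le_japaneseBracket z))⟩
  refine (hopen.measure_pos volume hne).ne' ?_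
  rw [ae_iff] at hae
  simpa only [not_le] using hae

theorem integral_biharmonicBump_pos : 0 < ∫ y, biharmonicBump 1 y := by
  have hpos : ∀ y, 0 < biharmonicBump 1 y := fun y => by
    unfold biharmonicBump
    positivity
  rw [integral_pos_iff_support_of_nonneg (fun y => (hpos y).le) (integrable_biharmonicBump one_pos)]
  have : Function.support (biharmonicBump 1) = Set.univ :=
    Set.eq_univ_of_forall fun y => (hpos y).ne'
  rw [this]
  exact isOpen_univ.measure_pos volume Set.univ_nonempty

/-- Bounded distributional solutions are logarithmic potentials up to a constant. -/
theorem IsLogPotential.exists_representation (hV : IsLogPotential V C)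
    (hu : StronglyMeasurable u) (hM : ∀ x, ‖u x‖ ≤ M) (hVu : IsDistribSolution V u) :
    (∫ y, (V y : ℂ) * u y = 0) ∧ ∃ c : ℂ, ∀ᵐ z, (∫ y, biharmonicBump 1 y : ℝ) * u z =
      c + 2 * ∫ y, (V y : ℂ) * u y * logKernel z y := by
  obtain ⟨c, hc⟩ := hV.exists_eq_const_add_logPotential hu hM hVu
  have h0 := hV.integral_eq_zero hu hM hc
  refine ⟨h0, c, ?_⟩
  filter_upwards [hc] with z hz
  rw [hz, hV.logPotential_eq hu hM, h0, mul_zero, zero_add]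

/-- A pointwise bound of bounded solutions by a quadratic functional. -/
theorem IsLogPotential.exists_norm_le (hV : IsLogPotential V C) : ∃ D : ℝ, 0 ≤ D ∧
    ∀ (u : R4 → ℂ) (M : ℝ), StronglyMeasurable u → (∀ x, ‖u x‖ ≤ M) → IsDistribSolution V u →
      ∀ᵐ x, ∀ t : ℝ, 0 < t → ‖u x‖ ≤ D * (t + ((∫ y, |V y| * ‖u y‖ ^ 2) +
        ∫ y in Metric.ball (0 : R4) 1, ‖u y‖ ^ 2) / t) := by
  have hC : 0 ≤ C := (integral_nonneg fun y => mul_nonneg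
    (zero_le_one.trans (one_le_logWeight y)) (abs_nonneg _)).trans hV.le
  have hκ := integral_biharmonicBump_pos
  set κ := ∫ y, biharmonicBump 1 y
  set b := volume.real (Metric.ball (0 : R4) 1)
  have hb : 0 < b := ENNReal.toReal_pos (Metric.measure_ball_pos _ _ one_pos).ne'
    measure_ball_lt_top.ne
  -- The sum of all coefficients occurring below: `κ` and `κ/b` from the bound of `c`, `18C` and `2`
  -- from using the potential bound twice, all divided by `κ`.
  refine ⟨(κ + 18 * C + 2 + κ / b) / κ, by positivity, fun u M hu hM hVu => ?_⟩
  obtain ⟨-, c, hc⟩ := hV.exists_representation hu hM hVu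
  set Q₁ := ∫ y, |V y| * ‖u y‖ ^ 2
  set Q₂ := ∫ y in Metric.ball (0 : R4) 1, ‖u y‖ ^ 2
  have hQ₁ : 0 ≤ Q₁ := integral_nonneg fun y => by positivity
  have hQ₂ : 0 ≤ Q₂ := integral_nonneg fun y => by positivity
  have hui : IntegrableOn (fun y => ‖u y‖ ^ 2) (Metric.ball (0 : R4) 1) volume :=
    Measure.integrableOn_of_bounded (M := M ^ 2) measure_ball_lt_top.ne
      (hu.norm.pow 2).aestronglyMeasurable (Eventually.of_forall fun y => by
        rw [Real.norm_of_nonneg (by positivity)]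
        exact pow_le_pow_left₀ (norm_nonneg _) (hM y) 2)
  have hc' : ∀ t : ℝ, 0 < t → ‖c‖ ≤ κ * t + κ / b * Q₂ / t + (9 * C * t + Q₁ / t) := by
    intro t ht
    -- The constant `c` is not seen by the potential; solving the representation for it and
    -- averaging over the unit ball bounds it by the local `L²` norm of `u`.
    have hae : ∀ᵐ y : R4, ‖c‖ ≤ κ * t + (9 * C * t + Q₁ / t) + κ / t * ‖u y‖ ^ 2 := by
      filter_upwards [hc] with y hy
      have h1 := (hV.integrable_mul_logKernel hu hM y).2 t ht
      have h2 : c = κ * u y - 2 * ∫ x, (V x : ℂ) * u x * logKernel y x := by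
        rw [hy]
        ring
      have h3 := norm_sub_le (κ * u y) (2 * ∫ x, (V x : ℂ) * u x * logKernel y x)
      rw [← h2, norm_mul, norm_mul, Complex.norm_real, Real.norm_of_nonneg hκ.le,
        Complex.norm_ofNat] at h3
      have h4 : ‖u y‖ ≤ t + ‖u y‖ ^ 2 / t := by
        rw [← sub_nonneg, show t + ‖u y‖ ^ 2 / t - ‖u y‖ =
          ((t - ‖u y‖ / 2) ^ 2 + 3 / 4 * ‖u y‖ ^ 2) / t by field_simp; ring]
        positivity
      have h5 := mul_le_mul_of_nonneg_left h4 hκ.le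
      rw [mul_add, ← mul_div_assoc, mul_div_right_comm] at h5
      linarith
    have hconst : IntegrableOn (fun _ => κ * t + (9 * C * t + Q₁ / t)) (Metric.ball (0 : R4) 1)
        volume := integrableOn_const measure_ball_lt_top.ne
    have hint := setIntegral_mono_ae (s := Metric.ball (0 : R4) 1) (μ := volume)
      (f := fun _ => ‖c‖) (integrableOn_const measure_ball_lt_top.ne)
      (hconst.add (hui.const_mul (κ / t))) hae
    simp only [Pi.add_apply] at hint
    rw [integral_add hconst (hui.const_mul (κ / t)),
      integral_const_mul, setIntegral_const, setIntegral_const, smul_eq_mul, smul_eq_mul] at hint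
    have h6 : ‖c‖ ≤ (b * (κ * t + (9 * C * t + Q₁ / t)) + κ / t * Q₂) / b := by
      rw [le_div_iff₀ hb, mul_comm]
      exact hint
    refine h6.trans (le_of_eq ?_)
    field_simp
    ring
  filter_upwards [hc] with x hx t ht
  have h1 := (hV.integrable_mul_logKernel hu hM x).2 t ht
  have h2 := congrArg norm hx
  rw [norm_mul, Complex.norm_real, Real.norm_of_nonneg hκ.le] at h2
  have h3 := norm_add_le c (2 * ∫ y, (V y : ℂ) * u y * logKernel x y)
  rw [norm_mul, Complex.norm_ofNat] at h3
  have h4 := hc' t ht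
  rw [div_mul_eq_mul_div, le_div_iff₀ hκ, mul_comm]
  have h5 : 0 ≤ Q₁ / t := by positivity
  have h6 : 0 ≤ Q₂ / t := by positivity
  have h7 : 0 ≤ κ / b := by positivity
  rw [add_div, mul_div_assoc] at *
  have h8 : (κ + 18 * C + 2 + κ / b) * (t + (Q₁ / t + Q₂ / t)) =
      (κ * t + κ / b * (Q₂ / t) + 2 * (9 * C * t + Q₁ / t)) + (2 * t + κ / b * t +
        (κ + 18 * C + κ / b) * (Q₁ / t) + (κ + 18 * C + 2) * (Q₂ / t)) := by ring
  have h9 : 0 ≤ 2 * t + κ / b * t +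
        (κ + 18 * C + κ / b) * (Q₁ / t) + (κ + 18 * C + 2) * (Q₂ / t) := by positivity
  linarith
end

/-! ### Grothendieck's theorem on subspaces of `L²` with bounded sup norm -/

section
variable {X : Type*} [MeasurableSpace X] {μ : Measure X}

theorem Lp.norm_sq_eq_integral (f : Lp ℂ 2 μ) :
    ‖f‖ ^ 2 = ∫ x, ‖f x‖ ^ 2 ∂μ := by
  have h3 := L2.inner_def (𝕜 := ℂ) f f
  rw [inner_self_eq_norm_sq_to_K] at h3
  have h4 : ∀ x, inner ℂ (f x) (f x) = ((‖f x‖ ^ 2 : ℝ) : ℂ) := fun x => by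
    rw [inner_self_eq_norm_sq_to_K]
    push_cast
    rfl
  simp_rw [h4] at h3
  rw [integral_complex_ofReal] at h3
  have h5 : ((‖f‖ ^ 2 : ℝ) : ℂ) = ((∫ x, ‖f x‖ ^ 2 ∂μ : ℝ) : ℂ) := by
    rw [← h3]
    push_cast
    rfl
  exact_mod_cast h5

/-- Apply the sup bound to `∑ aᵢ bᵢ` with `aᵢ` the conjugate of `bᵢ(x)`. Since these coefficients
depend on `x`, one null set must serve all `a`: a countable dense set and continuity provide it. -/
theorem Orthonormal.sum_norm_sq_ae_le {n : ℕ} {N : Submodule ℂ (Lp ℂ 2 μ)} {C : ℝ}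
    (h : ∀ f ∈ N, ∀ᵐ x ∂μ, ‖f x‖ ≤ C * ‖f‖) {b : Fin n → Lp ℂ 2 μ} (hb : Orthonormal ℂ b)
    (hbN : ∀ i, b i ∈ N) : ∀ᵐ x ∂μ, ∑ i, ‖b i x‖ ^ 2 ≤ C ^ 2 := by
  have hnorm : ∀ a : EuclideanSpace ℂ (Fin n), ‖∑ i, a i • b i‖ = ‖a‖ := by
    intro a
    have h1 := hb.inner_sum (fun i => a i) (fun i => a i) Finset.univ
    rw [← sq_eq_sq₀ (norm_nonneg _) (norm_nonneg _), EuclideanSpace.norm_sq_eq]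
    have h2 : ((‖∑ i, a i • b i‖ ^ 2 : ℝ) : ℂ) = ((∑ i, ‖a i‖ ^ 2 : ℝ) : ℂ) := by
      push_cast
      refine (inner_self_eq_norm_sq_to_K (𝕜 := ℂ) (∑ i, a i • b i)).symm.trans (h1.trans ?_)
      refine Finset.sum_congr rfl fun i _ => ?_
      exact Complex.conj_mul' (a i)
    exact_mod_cast h2
  have hae : ∀ a : EuclideanSpace ℂ (Fin n), ∀ᵐ x ∂μ, ‖∑ i, a i * b i x‖ ≤ C * ‖a‖ := by
    intro a
    have h1 := h (∑ i, a i • b i) (N.sum_mem fun i _ => N.smul_mem _ (hbN i))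
    have h2 : ∀ᵐ x ∂μ, ∀ i, (a i • b i : Lp ℂ 2 μ) x = a i * b i x :=
      ae_all_iff.2 fun i => Lp.coeFn_smul (a i) (b i)
    filter_upwards [h1, h2, Lp.coeFn_finsetSum Finset.univ fun i => a i • b i] with x h3 h4 h5
    rw [hnorm, h5, Finset.sum_apply] at h3
    simpa only [h4] using h3
  have hall : ∀ᵐ x ∂μ, ∀ a : EuclideanSpace ℂ (Fin n), ‖∑ i, a i * b i x‖ ≤ C * ‖a‖ := by
    have h1 : ∀ᵐ x ∂μ, ∀ k : ℕ,
        ‖∑ i, TopologicalSpace.denseSeq (EuclideanSpace ℂ (Fin n)) k i * b i x‖ ≤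
          C * ‖TopologicalSpace.denseSeq (EuclideanSpace ℂ (Fin n)) k‖ :=
      ae_all_iff.2 fun k => hae _
    filter_upwards [h1] with x hx a
    have hcl : IsClosed {a : EuclideanSpace ℂ (Fin n) | ‖∑ i, a i * b i x‖ ≤ C * ‖a‖} :=
      isClosed_le (by fun_prop) (by fun_prop)
    have hd := TopologicalSpace.denseRange_denseSeq (EuclideanSpace ℂ (Fin n))
    exact hd.induction_on (p := fun a => ‖∑ i, a i * b i x‖ ≤ C * ‖a‖) a hcl hx
  filter_upwards [hall] with x hx
  -- With this choice the bound reads `S ≤ C √S`.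
  have h1 := hx (WithLp.toLp 2 fun i => starRingEnd ℂ (b i x))
  set S : ℝ := ∑ i, ‖b i x‖ ^ 2 with hS
  have hS0 : 0 ≤ S := Finset.sum_nonneg fun i _ => sq_nonneg _
  have h2 : ‖(WithLp.toLp 2 fun i => starRingEnd ℂ (b i x) : EuclideanSpace ℂ (Fin n))‖ ^ 2 = S := by
    rw [EuclideanSpace.norm_sq_eq]
    simp [hS]
  have h3 : ‖∑ i, (WithLp.toLp 2 fun i => starRingEnd ℂ (b i x) : EuclideanSpace ℂ (Fin n)) i *
      b i x‖ = S := by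
    have : ∑ i, (WithLp.toLp 2 fun i => starRingEnd ℂ (b i x) : EuclideanSpace ℂ (Fin n)) i *
        b i x = (S : ℂ) := by
      rw [hS]
      push_cast
      exact Finset.sum_congr rfl fun i _ => Complex.conj_mul' (b i x)
    rw [this, Complex.norm_real, Real.norm_of_nonneg hS0]
  rw [h3] at h1
  have h4 := pow_le_pow_left₀ hS0 h1 2
  rw [mul_pow, h2] at h4
  rcases hS0.eq_or_lt with h0 | h0
  · rw [← h0]
    positivity
  · nlinarith

/-- Grothendieck's theorem: a subspace of `L²` of a finite measure on which the sup norm is bounded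
by the `L²` norm is finite-dimensional. -/
theorem finiteDimensional_of_ae_norm_le [IsFiniteMeasure μ] (N : Submodule ℂ (Lp ℂ 2 μ)) {C : ℝ}
    (h : ∀ f ∈ N, ∀ᵐ x ∂μ, ‖f x‖ ≤ C * ‖f‖) : FiniteDimensional ℂ N := by
  -- Integrating `∑ |bᵢ|² ≤ C²` over the finite measure bounds the length of any orthonormal family
  -- in `N`.
  have hcard : ∀ (n : ℕ) (b : Fin n → Lp ℂ 2 μ), Orthonormal ℂ b → (∀ i, b i ∈ N) →
      (n : ℝ) ≤ C ^ 2 * μ.real Set.univ := by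
    intro n b hb hbN
    have h1 := hb.sum_norm_sq_ae_le h hbN
    have hi : ∀ i, Integrable (fun x => ‖b i x‖ ^ 2) μ := fun i =>
      (Lp.memLp (b i)).integrable_norm_pow two_ne_zero
    have h2 : ∀ i, ∫ x, ‖b i x‖ ^ 2 ∂μ = 1 := by
      intro i
      rw [← Lp.norm_sq_eq_integral, hb.1 i, one_pow]
    have h6 := integral_mono_ae (integrable_finsetSum Finset.univ fun i _ => hi i)
      (integrable_const (C ^ 2)) h1
    rw [integral_finsetSum _ fun i _ => hi i, integral_const] at h6
    simp only [h2, Finset.sum_const, Finset.card_univ, Fintype.card_fin, nsmul_eq_mul, mul_one,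
      smul_eq_mul] at h6
    rwa [mul_comm]
  have hrank : Module.rank ℂ N ≤ (⌊C ^ 2 * μ.real Set.univ⌋₊ : ℕ) := by
    refine rank_le fun s hs => ?_
    have hfin := finrank_span_finset_eq_card (R := ℂ) (s := s) hs
    let b := stdOrthonormalBasis ℂ (Submodule.span ℂ (s : Set N))
    have hb : Orthonormal ℂ fun i => ((b i : N) : Lp ℂ 2 μ) :=
      (b.orthonormal.comp_linearIsometry (Submodule.subtypeₗᵢ _)).comp_linearIsometry
        N.subtypeₗᵢ
    have h1 := hcard _ _ hb fun i => (b i : N).2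
    rw [hfin] at h1
    exact Nat.le_floor h1
  exact Module.rank_lt_aleph0_iff.1 (hrank.trans_lt (Cardinal.natCast_lt_aleph0))

end

/-! ### Finite dimension of the resonance space -/

theorem exists_bounded_representative (φ : Lp ℂ ∞ (volume : Measure R4)) :
    ∃ (u : R4 → ℂ) (M : ℝ), StronglyMeasurable u ∧ (∀ x, ‖u x‖ ≤ M) ∧ φ =ᵐ[volume] u := by
  obtain ⟨M, hM0, hM⟩ := (Lp.memLp φ).exists_ae_norm_le
  refine ⟨{x | ‖φ x‖ ≤ M}.indicator φ, M, (Lp.stronglyMeasurable φ).indicator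
    (measurableSet_le (Lp.stronglyMeasurable φ).norm.measurable measurable_const), fun x => ?_, ?_⟩
  · by_cases hx : ‖φ x‖ ≤ M
    · rwa [Set.indicator_of_mem (Set.mem_ofPred_eq ▸ hx)]
    · rw [Set.indicator_of_notMem (Set.mem_ofPred_eq ▸ hx), norm_zero]
      exact hM0
  · filter_upwards [hM] with x hx
    rw [Set.indicator_of_mem (Set.mem_ofPred_eq ▸ hx)]

/-- The finite measure `|V| dx + 1_{B(0,1)} dx`. -/
noncomputable def potentialMeasure (V : R4 → ℝ) : Measure R4 :=
  (volume.withDensity fun x => ENNReal.ofReal |V x|) + volume.restrict (Metric.ball 0 1)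

theorem potentialMeasure_absolutelyContinuous (V : R4 → ℝ) : potentialMeasure V ≪ volume :=
  Measure.AbsolutelyContinuous.add_left (withDensity_absolutelyContinuous _ _)
    Measure.restrict_le_self.absolutelyContinuous

theorem IsLogPotential.isFiniteMeasure {V : R4 → ℝ} {C : ℝ} (hV : IsLogPotential V C) :
    IsFiniteMeasure (potentialMeasure V) := by
  have h1 : IsFiniteMeasure (volume.withDensity fun x => ENNReal.ofReal |V x|) :=
    isFiniteMeasure_withDensity_ofReal hV.integrable_abs.2
  have h2 : IsFiniteMeasure ((volume : Measure R4).restrict (Metric.ball 0 1)) :=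
    ⟨by simpa using measure_ball_lt_top⟩
  unfold potentialMeasure
  infer_instance

theorem IsLogPotential.integral_potentialMeasure {V : R4 → ℝ} {C M : ℝ} {u : R4 → ℂ}
    (hV : IsLogPotential V C) (hu : StronglyMeasurable u) (hM : ∀ x, ‖u x‖ ≤ M) :
    ∫ x, ‖u x‖ ^ 2 ∂(potentialMeasure V) =
      (∫ y, |V y| * ‖u y‖ ^ 2) + ∫ y in Metric.ball (0 : R4) 1, ‖u y‖ ^ 2 := by
  have := hV.isFiniteMeasure
  have hi : Integrable (fun x => ‖u x‖ ^ 2) (potentialMeasure V) :=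
    Integrable.of_bound (hu.norm.pow 2).aestronglyMeasurable (M ^ 2) (Eventually.of_forall fun x => by
      rw [Real.norm_of_nonneg (by positivity)]
      exact pow_le_pow_left₀ (norm_nonneg _) (hM x) 2)
  rw [potentialMeasure] at hi ⊢
  rw [integral_add_measure hi.left_of_add_measure hi.right_of_add_measure,
    integral_withDensity_eq_integral_toReal_smul₀
      (continuous_abs.comp_aestronglyMeasurable hV.aesm).aemeasurable.ennreal_ofReal
      (Eventually.of_forall fun x => ENNReal.ofReal_lt_top)]
  simp

theorem IsLogPotential.memLp_two {V : R4 → ℝ} {C : ℝ} (hV : IsLogPotential V C)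
    (φ : Lp ℂ ∞ (volume : Measure R4)) : MemLp φ 2 (potentialMeasure V) := by
  have := hV.isFiniteMeasure
  obtain ⟨M, -, hM⟩ := (Lp.memLp φ).exists_ae_norm_le
  exact MemLp.of_bound (Lp.stronglyMeasurable φ).aestronglyMeasurable M
    ((potentialMeasure_absolutelyContinuous V).ae_le hM)

/-- The map `L^∞(dx) → L²(|V| dx + 1_{B(0,1)} dx)`. -/
noncomputable def IsLogPotential.toL2 {V : R4 → ℝ} {C : ℝ} (hV : IsLogPotential V C) :
    Lp ℂ ∞ (volume : Measure R4) →ₗ[ℂ] Lp ℂ 2 (potentialMeasure V) where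
  toFun φ := (hV.memLp_two φ).toLp φ
  map_add' φ ψ := by
    rw [← MemLp.toLp_add]
    exact MemLp.toLp_congr _ _
      ((potentialMeasure_absolutelyContinuous V).ae_le (Lp.coeFn_add φ ψ))
  map_smul' c φ := by
    rw [RingHom.id_apply, ← MemLp.toLp_const_smul]
    exact MemLp.toLp_congr _ _
      ((potentialMeasure_absolutelyContinuous V).ae_le (Lp.coeFn_smul c φ))

theorem IsLogPotential.exists_norm_le_toL2 {V : R4 → ℝ} {C : ℝ} (hV : IsLogPotential V C) :
    ∃ D : ℝ, ∀ φ ∈ zeroResonanceSpace V, ∀ᵐ x, ‖φ x‖ ≤ D * ‖hV.toL2 φ‖ := by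
  obtain ⟨D, hD, hle⟩ := hV.exists_norm_le
  refine ⟨2 * D, fun φ hφ => ?_⟩
  obtain ⟨u, M, hu, hM, hφu⟩ := exists_bounded_representative φ
  have hsol : IsDistribSolution V u := IsDistribSolution.congr hφu hφ
  have hnorm : ‖hV.toL2 φ‖ ^ 2 =
      (∫ y, |V y| * ‖u y‖ ^ 2) + ∫ y in Metric.ball (0 : R4) 1, ‖u y‖ ^ 2 := by
    rw [← hV.integral_potentialMeasure hu hM, Lp.norm_sq_eq_integral]
    refine integral_congr_ae ?_
    filter_upwards [(hV.memLp_two φ).coeFn_toLp,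
      (potentialMeasure_absolutelyContinuous V).ae_le hφu] with x h1 h2
    change ‖(hV.memLp_two φ).toLp φ x‖ ^ 2 = _
    rw [h1, h2]
  filter_upwards [hle u M hu hM hsol, hφu] with x hx h2
  rw [h2]
  rw [← hnorm] at hx
  -- The optimal parameter `t` is the `L²` norm itself, which gives the factor `2`; when the norm is
  -- zero, `t` is sent to `0`.
  rcases (norm_nonneg (hV.toL2 φ)).eq_or_lt with h0 | h0
  · rw [← h0] at hx ⊢
    rw [mul_zero]
    refine le_of_forall_pos_le_add fun e he => ?_
    refine (hx (e / (D + 1)) (by positivity)).trans ?_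
    simp only [ne_eq, OfNat.ofNat_ne_zero, not_false_eq_true, zero_pow, zero_div, add_zero, zero_add]
    rw [← mul_div_assoc, div_le_iff₀ (by positivity)]
    nlinarith
  · refine (hx _ h0).trans (le_of_eq ?_)
    field_simp
    ring

theorem IsLogPotential.finiteDimensional {V : R4 → ℝ} {C : ℝ} (hV : IsLogPotential V C) :
    FiniteDimensional ℂ (zeroResonanceSpace V) := by
  have := hV.isFiniteMeasure
  obtain ⟨D, hD⟩ := hV.exists_norm_le_toL2
  let J := hV.toL2.domRestrict (zeroResonanceSpace V)
  -- The measure may ignore large sets where `V = 0`, but the sup bound holds almost everywhere for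
  -- Lebesgue measure, so a solution of zero norm vanishes.
  have hinj : Function.Injective J := by
    rw [← LinearMap.ker_eq_bot, LinearMap.ker_eq_bot']
    intro φ hφ
    have h1 := hD φ.1 φ.2
    have h2 : hV.toL2 φ.1 = 0 := hφ
    rw [h2, norm_zero, mul_zero] at h1
    refine Subtype.ext ((Lp.eq_zero_iff_ae_eq_zero).2 ?_)
    filter_upwards [h1] with x hx using norm_le_zero_iff.1 hx
  have hfin : FiniteDimensional ℂ (LinearMap.range J) := by
    refine finiteDimensional_of_ae_norm_le _ (C := D) ?_
    rintro _ ⟨φ, rfl⟩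
    filter_upwards [(hV.memLp_two φ.1).coeFn_toLp,
      (potentialMeasure_absolutelyContinuous V).ae_le (hD φ.1 φ.2)] with x h1 h2
    change ‖(hV.memLp_two φ.1).toLp φ.1 x‖ ≤ _
    rw [h1]
    exact h2
  exact (LinearEquiv.ofInjective J hinj).symm.finiteDimensional

/-! ### Second-order expansion of the logarithm at infinity -/

/-- The remainder of the second-order expansion of `log |x - y|²` as `x → ∞`. -/
noncomputable def logRemainder (x y : R4) : ℝ :=
  2 * Real.log ‖x - y‖ - 2 * Real.log ‖x‖ + 2 * inner ℝ x y / ‖x‖ ^ 2 - ‖y‖ ^ 2 / ‖x‖ ^ 2 +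
    2 * inner ℝ x y ^ 2 / ‖x‖ ^ 4

/-- With `p = x·y/|x|²` and `η = |y|/|x|`, one has `|x - y|² = |x|²(1 - ρ)`, `ρ = 2p - η²`. The
quadratic Taylor polynomial of `log(1 - ρ)` reproduces the subtracted terms up to `2pη²` and `η⁴/2`.
-/
theorem abs_logRemainder_le_of_le {x y : R4} (hx : x ≠ 0) (h : 4 * ‖y‖ ≤ ‖x‖) :
    |logRemainder x y| ≤ 29 * (‖y‖ / ‖x‖) ^ 3 := by
  have hr : 0 < ‖x‖ := norm_pos_iff.2 hx
  set r := ‖x‖ with hr_def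
  set η := ‖y‖ / r with hη
  set p := inner ℝ x y / r ^ 2 with hp
  have hη0 : 0 ≤ η := by positivity
  have hη1 : η ≤ 1 / 4 := by
    rw [hη, div_le_iff₀ hr]
    linarith
  have hpη : |p| ≤ η := by
    rw [hp, hη, abs_div, abs_of_pos (pow_pos hr 2), div_le_div_iff₀ (by positivity) hr]
    nlinarith [abs_real_inner_le_norm x y]
  have hd : ‖x - y‖ ^ 2 = r ^ 2 * (1 - (2 * p - η ^ 2)) := by
    rw [norm_sub_sq_real, hp, hη]
    field_simp
    ring
  obtain ⟨hp1, hp2⟩ := abs_le.1 hpη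
  set ρ := 2 * p - η ^ 2 with hρ
  have hρ1 : |ρ| ≤ 9 / 4 * η := by
    rw [abs_le]
    constructor <;> nlinarith
  have hρ2 : |ρ| ≤ 9 / 16 := by linarith
  have hlog : 2 * Real.log ‖x - y‖ - 2 * Real.log r = Real.log (1 - ρ) := by
    have h1 : Real.log (‖x - y‖ ^ 2) = Real.log (r ^ 2 * (1 - ρ)) := by rw [hd]
    have h2 : 1 - ρ ≠ 0 := by linarith [le_abs_self ρ]
    rw [Real.log_mul (by positivity) h2, Real.log_pow, Real.log_pow] at h1
    push_cast at h1
    linarith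
  have hE : logRemainder x y = (ρ + ρ ^ 2 / 2 + Real.log (1 - ρ)) + 2 * p * η ^ 2 - η ^ 4 / 2 := by
    have e1 : 2 * inner ℝ x y / r ^ 2 = 2 * p := by rw [hp, mul_div_assoc]
    have e2 : ‖y‖ ^ 2 / r ^ 2 = η ^ 2 := by rw [hη, div_pow]
    have e3 : 2 * inner ℝ x y ^ 2 / r ^ 4 = 2 * p ^ 2 := by
      rw [hp]
      field_simp
    rw [logRemainder, ← hr_def, hlog, e1, e2, e3, hρ]
    ring
  have hT := Real.abs_log_sub_add_sum_range_le (x := ρ) (by linarith) 2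
  simp only [Finset.sum_range_succ, Finset.range_zero, Finset.sum_empty, zero_add, pow_one,
    Nat.cast_zero, Nat.cast_one, div_one, Nat.reduceAdd] at hT
  -- `(9/4)³ / (1 - 9/16)` is just below `26.1`. The leftovers `2pη²` and `η⁴/2` add at most `2η³`
  -- and `η³/8`, whence `29`.
  have hT2 : |ρ| ^ 3 / (1 - |ρ|) ≤ 26.1 * η ^ 3 := by
    rw [div_le_iff₀ (by linarith)]
    have h1 : |ρ| ^ 3 ≤ (9 / 4 * η) ^ 3 := pow_le_pow_left₀ (abs_nonneg _) hρ1 3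
    nlinarith [pow_nonneg hη0 3]
  have hT3 : |ρ + ρ ^ 2 / 2 + Real.log (1 - ρ)| ≤ 26.1 * η ^ 3 := by
    refine le_trans ?_ (hT.trans hT2)
    norm_num
  obtain ⟨h1, h2⟩ := abs_le.1 hT3
  have h3 : η ^ 4 ≤ η ^ 3 / 4 := by
    nlinarith [pow_nonneg hη0 3]
  have h4 : 0 ≤ η ^ 4 := by positivity
  have h5 : 0 ≤ η ^ 3 := by positivity
  rw [hE, abs_le]
  constructor <;> nlinarith [mul_le_mul_of_nonneg_right hp1 (sq_nonneg η),
    mul_le_mul_of_nonneg_right hp2 (sq_nonneg η)]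

/-- No cancellation is needed here: since `η = |y|/|x| > 1/4`, every term of the expansion is
estimated separately and lower powers of `η` are raised to `η³` at the cost of powers of `4`. -/
theorem abs_logRemainder_le_of_lt {x y : R4} (hx : x ≠ 0) (h : ‖x‖ < 4 * ‖y‖) :
    |logRemainder x y| ≤
      (‖y‖ / ‖x‖) ^ 3 * (332 + 128 * |Real.log ‖y‖| + 128 * negLog ‖x - y‖) := by
  have hr : 0 < ‖x‖ := norm_pos_iff.2 hx
  have hn : 0 < ‖y‖ := by linarith
  set r := ‖x‖ with hr_def
  set η := ‖y‖ / r with hη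
  set p := inner ℝ x y / r ^ 2 with hp
  have hη1 : 1 / 4 < η := by
    rw [hη, lt_div_iff₀ hr]
    linarith
  have hη0 : 0 < η := by linarith
  have hpη : |p| ≤ η := by
    rw [hp, hη, abs_div, abs_of_pos (pow_pos hr 2), div_le_div_iff₀ (by positivity) hr]
    nlinarith [abs_real_inner_le_norm x y]
  have hη2 : η ^ 2 ≤ 4 * η ^ 3 := by nlinarith [pow_pos hη0 2]
  have hη3 : η ≤ 16 * η ^ 3 := by nlinarith [pow_pos hη0 2]
  have hη4 : 1 ≤ 64 * η ^ 3 := by nlinarith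
  have hL := abs_nonneg (Real.log ‖y‖)
  have hN := negLog_nonneg ‖x - y‖
  have hlog : |Real.log ‖x - y‖ - Real.log r| ≤
      16 * η ^ 3 + 64 * η ^ 3 * (2 + |Real.log ‖y‖| + negLog ‖x - y‖) := by
    have hlogr : Real.log r ≤ 2 + |Real.log ‖y‖| := by
      have h1 := Real.log_le_log hr h.le
      rw [Real.log_mul (by norm_num) hn.ne', show (4 : ℝ) = 2 ^ 2 by norm_num, Real.log_pow] at h1
      push_cast at h1
      have h2 := Real.log_two_lt_d9
      linarith [le_abs_self (Real.log ‖y‖)]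
    have hbig : 2 + |Real.log ‖y‖| + negLog ‖x - y‖ ≤
        64 * η ^ 3 * (2 + |Real.log ‖y‖| + negLog ‖x - y‖) :=
      le_mul_of_one_le_left (by positivity) hη4
    have h3 : 0 ≤ η ^ 3 := by positivity
    refine abs_le.2 ⟨?_, ?_⟩
    · linarith [neg_log_le_negLog ‖x - y‖]
    · rcases (norm_nonneg (x - y)).eq_or_lt with h0 | h0
      -- At `y = x` the logarithm has its default value `0`, and `-log|x| = -log|y|` remains to be
      -- bounded.
      · have h4 : -Real.log r ≤ |Real.log ‖y‖| + η := by
          have h5 : r = ‖y‖ := congrArg norm (sub_eq_zero.1 (norm_eq_zero.1 h0.symm))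
          rw [h5]
          linarith [neg_le_abs (Real.log ‖y‖)]
        rw [← h0, Real.log_zero]
        rw [← h0] at hbig hN
        linarith
      · have h4 : ‖x - y‖ ≤ r * (1 + η) := by
          have := norm_sub_le x y
          rw [hη]
          field_simp
          exact this
        have h5 := Real.log_le_log h0 h4
        rw [Real.log_mul hr.ne' (by positivity)] at h5
        have h6 := Real.log_le_sub_one_of_pos (show 0 < 1 + η by positivity)
        linarith
  have e1 : 2 * inner ℝ x y / r ^ 2 = 2 * p := by rw [hp, mul_div_assoc]
  have e2 : ‖y‖ ^ 2 / r ^ 2 = η ^ 2 := by rw [hη, div_pow]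
  have e3 : 2 * inner ℝ x y ^ 2 / r ^ 4 = 2 * p ^ 2 := by
    rw [hp]
    field_simp
  rw [logRemainder, ← hr_def, e1, e2, e3]
  have hp3 : p ^ 2 ≤ η ^ 2 := sq_le_sq' (abs_le.1 hpη).1 (abs_le.1 hpη).2
  obtain ⟨h1, h2⟩ := abs_le.1 hlog
  obtain ⟨h3, h4⟩ := abs_le.1 hpη
  rw [abs_le]
  -- The constant is `2(16 + 128)` from the logarithms plus `32`, `4` and `8` from `2p`, `η²` and
  -- `2p²`.
  constructor <;> nlinarith [sq_nonneg p]

theorem abs_logRemainder_le {x : R4} (hx : x ≠ 0) (y : R4) :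
    |logRemainder x y| ≤ (‖x‖ ^ 3)⁻¹ * (460 * logWeight y +
      128 * (negLog ‖x - y‖ * logWeight y)) := by
  have hr : 0 < ‖x‖ := norm_pos_iff.2 hx
  have hN := negLog_nonneg ‖x - y‖
  have hL := norm_le_japaneseBracket (Real.log ‖y‖)
  rw [Real.norm_eq_abs] at hL
  have hL1 := one_le_japaneseBracket (Real.log ‖y‖)
  have hy3 : ‖y‖ ^ 3 ≤ japaneseBracket y ^ 3 :=
    pow_le_pow_left₀ (norm_nonneg _) (norm_le_japaneseBracket y) 3
  have h0 : (0 : ℝ) ≤ (‖y‖ / ‖x‖) ^ 3 := by positivity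
  -- `460 = 332 + 128`, because both `1` and `|log|y||` are at most `⟨log|y|⟩`.
  have h1 : |logRemainder x y| ≤ (‖y‖ / ‖x‖) ^ 3 *
      (460 * japaneseBracket (Real.log ‖y‖) + 128 * negLog ‖x - y‖) := by
    rcases le_or_gt (4 * ‖y‖) ‖x‖ with h | h
    · refine (abs_logRemainder_le_of_le hx h).trans ?_
      rw [mul_comm]
      exact mul_le_mul_of_nonneg_left (by linarith) h0
    · refine (abs_logRemainder_le_of_lt hx h).trans ?_
      exact mul_le_mul_of_nonneg_left (by linarith) h0
  refine h1.trans ?_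
  rw [div_pow, div_eq_inv_mul, mul_assoc]
  refine mul_le_mul_of_nonneg_left ?_ (by positivity)
  have h2 := japaneseBracket_log_mul_le_logWeight y
  have h3 := japaneseBracket_pow_three_le_logWeight y
  have h4 : ‖y‖ ^ 3 * japaneseBracket (Real.log ‖y‖) ≤ logWeight y := by
    refine le_trans ?_ h2
    rw [mul_comm]
    exact mul_le_mul_of_nonneg_left hy3 (by linarith)
  have h5 : negLog ‖x - y‖ * ‖y‖ ^ 3 ≤ negLog ‖x - y‖ * logWeight y :=
    mul_le_mul_of_nonneg_left (hy3.trans h3) hN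
  linarith

/-! ### Moments of `V u` and the asymptotic expansion -/

section
variable {V : R4 → ℝ} {C M : ℝ} {u : R4 → ℂ}

theorem IsLogPotential.integrable_mul_of_abs_le (hV : IsLogPotential V C)
    (hu : StronglyMeasurable u) (hM : ∀ x, ‖u x‖ ≤ M) {g : R4 → ℝ} (hg : Measurable g)
    (hle : ∀ y, |g y| ≤ logWeight y) : Integrable (fun y => (V y : ℂ) * u y * g y) volume := by
  refine (hV.integrable.const_mul M).mono' ((hV.aestronglyMeasurable_mul hu).mul
    (Complex.continuous_ofReal.comp_aestronglyMeasurable hg.aestronglyMeasurable))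
    (Eventually.of_forall fun y => ?_)
  rw [norm_mul, Complex.norm_real]
  refine (mul_le_mul (norm_ofReal_mul_le hM y) (hle y) (abs_nonneg _)
    ((norm_nonneg _).trans (norm_ofReal_mul_le hM y))).trans (le_of_eq ?_)
  ring

theorem IsLogPotential.integrable_mul_logRemainder (hV : IsLogPotential V C)
    (hu : StronglyMeasurable u) (hM : ∀ x, ‖u x‖ ≤ M) {x : R4} (hx : x ≠ 0) :
    Integrable (fun y => (V y : ℂ) * u y * logRemainder x y) volume ∧
      ‖∫ y, (V y : ℂ) * u y * logRemainder x y‖ ≤ 588 * M * C * (‖x‖ ^ 3)⁻¹ := by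
  have hM0 : 0 ≤ M := (norm_nonneg _).trans (hM 0)
  have hi : Integrable (fun y => M * (‖x‖ ^ 3)⁻¹ * (460 * (logWeight y * |V y|) +
      128 * (negLog ‖x - y‖ * (logWeight y * |V y|)))) volume :=
    ((hV.integrable.const_mul 460).add ((hV.integrable_negLog x).const_mul 128)).const_mul _
  have hle : ∀ y, ‖(V y : ℂ) * u y * logRemainder x y‖ ≤
      M * (‖x‖ ^ 3)⁻¹ * (460 * (logWeight y * |V y|) +
        128 * (negLog ‖x - y‖ * (logWeight y * |V y|))) := by
    intro y
    rw [norm_mul, Complex.norm_real]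
    refine (mul_le_mul (norm_ofReal_mul_le hM y) (abs_logRemainder_le hx y) (abs_nonneg _)
      ((norm_nonneg _).trans (norm_ofReal_mul_le hM y))).trans (le_of_eq ?_)
    ring
  have hm : Measurable (logRemainder x) := by
    unfold logRemainder
    fun_prop
  refine ⟨hi.mono' ((hV.aestronglyMeasurable_mul hu).mul
    (Complex.continuous_ofReal.comp_aestronglyMeasurable hm.aestronglyMeasurable))
    (Eventually.of_forall hle),
    (norm_integral_le_of_norm_le hi (Eventually.of_forall hle)).trans ?_⟩
  rw [integral_const_mul, integral_add (hV.integrable.const_mul 460)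
    ((hV.integrable_negLog x).const_mul 128), integral_const_mul, integral_const_mul]
  have h1 : 460 * (∫ y, logWeight y * |V y|) +
      128 * (∫ y, negLog ‖x - y‖ * (logWeight y * |V y|)) ≤ 588 * C := by
    linarith [hV.le, hV.integral_negLog_le x]
  refine (mul_le_mul_of_nonneg_left h1 (by positivity)).trans (le_of_eq ?_)
  ring

theorem abs_coord_le_logWeight (i : Fin 4) (y : R4) : |y i| ≤ logWeight y :=
  (PiLp.norm_apply_le y i).trans ((norm_le_japaneseBracket y).trans
    ((le_self_pow₀ (one_le_japaneseBracket y) (by norm_num : 3 ≠ 0)).trans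
      (japaneseBracket_pow_three_le_logWeight y)))

theorem abs_coord_mul_coord_le_logWeight (i j : Fin 4) (y : R4) :
    |y i * y j| ≤ logWeight y := by
  rw [abs_mul]
  have h1 : |y i| ≤ japaneseBracket y := (PiLp.norm_apply_le y i).trans (norm_le_japaneseBracket y)
  have h2 : |y j| ≤ japaneseBracket y := (PiLp.norm_apply_le y j).trans (norm_le_japaneseBracket y)
  refine (mul_le_mul h1 h2 (abs_nonneg _) (japaneseBracket_pos y).le).trans ?_
  rw [← sq]
  exact (pow_le_pow_right₀ (one_le_japaneseBracket y) (by norm_num : 2 ≤ 3)).trans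
    (japaneseBracket_pow_three_le_logWeight y)

/-- Separates the variables, so that integrating against `V u` produces first and second moments.
The middle term does not depend on `y` and is annihilated by `∫ V u = 0`. -/
theorem two_mul_logKernel_eq (x y : R4) : 2 * logKernel x y = logRemainder x y +
    (2 * Real.log ‖x‖ - 2 * Real.log (japaneseBracket x)) +
    (∑ i, -2 * x i / ‖x‖ ^ 2 * y i + ∑ i, ∑ j, ((if i = j then 1 else 0) / ‖x‖ ^ 2 -
      2 * (x i * x j) / ‖x‖ ^ 4) * (y i * y j)) := by
  have h1 : inner ℝ x y = ∑ i, x i * y i := by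
    rw [PiLp.inner_apply]
    exact Finset.sum_congr rfl fun i _ => mul_comm _ _
  have h2 : ‖y‖ ^ 2 = ∑ i, y i * y i := by
    rw [EuclideanSpace.real_norm_sq_eq]
    exact Finset.sum_congr rfl fun i _ => sq _
  have e1 : ∑ i, -2 * x i / ‖x‖ ^ 2 * y i = -(2 * inner ℝ x y / ‖x‖ ^ 2) := by
    rw [h1, Finset.mul_sum, Finset.sum_div, ← Finset.sum_neg_distrib]
    exact Finset.sum_congr rfl fun i _ => by ring
  have e2 : ∑ i, ∑ j, ((if i = j then 1 else 0) / ‖x‖ ^ 2 -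
      2 * (x i * x j) / ‖x‖ ^ 4) * (y i * y j) =
      ‖y‖ ^ 2 / ‖x‖ ^ 2 - 2 * inner ℝ x y ^ 2 / ‖x‖ ^ 4 := by
    simp only [sub_mul, Finset.sum_sub_distrib]
    congr 1
    · rw [h2, Finset.sum_div]
      refine Finset.sum_congr rfl fun i _ => ?_
      rw [Finset.sum_eq_single i (fun j _ hj => by simp [hj.symm]) (by simp)]
      simp
      ring
    · rw [h1, sq, Finset.sum_mul_sum, Finset.mul_sum, Finset.sum_div]
      refine Finset.sum_congr rfl fun i _ => ?_
      rw [Finset.mul_sum, Finset.sum_div]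
      exact Finset.sum_congr rfl fun j _ => by ring
  rw [e1, e2, logKernel, logRemainder]
  ring

/-- The asymptotic expansion of bounded solutions, with complex coefficients. -/
theorem IsLogPotential.two_mul_integral_logKernel_eq (hV : IsLogPotential V C)
    (hu : StronglyMeasurable u) (hM : ∀ x, ‖u x‖ ≤ M) (h0 : ∫ y, (V y : ℂ) * u y = 0)
    {x : R4} (hx : x ≠ 0) :
    2 * ∫ y, (V y : ℂ) * u y * logKernel x y = (∫ y, (V y : ℂ) * u y * logRemainder x y) +
      (∑ i, ((-2 * x i / ‖x‖ ^ 2 : ℝ) : ℂ) * (∫ y, (V y : ℂ) * u y * (y i : ℝ)) +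
        ∑ i, ∑ j, (((if i = j then 1 else 0) / ‖x‖ ^ 2 - 2 * (x i * x j) / ‖x‖ ^ 4 : ℝ) : ℂ) *
          (∫ y, (V y : ℂ) * u y * (y i * y j : ℝ))) := by
  have hi1 : ∀ i : Fin 4, Integrable (fun y : R4 => (V y : ℂ) * u y * (y i : ℝ)) volume :=
    fun i => hV.integrable_mul_of_abs_le hu hM (by fun_prop) (abs_coord_le_logWeight i)
  have hi2 : ∀ i j : Fin 4,
      Integrable (fun y : R4 => (V y : ℂ) * u y * (y i * y j : ℝ)) volume :=
    fun i j => hV.integrable_mul_of_abs_le hu hM (by fun_prop)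
      (abs_coord_mul_coord_le_logWeight i j)
  have hR := (hV.integrable_mul_logRemainder hu hM hx).1
  have hv := hV.integrable_mul hu hM
  let L : ℂ := ((2 * Real.log ‖x‖ - 2 * Real.log (japaneseBracket x) : ℝ) : ℂ)
  let α : Fin 4 → ℂ := fun i => ((-2 * x i / ‖x‖ ^ 2 : ℝ) : ℂ)
  let β : Fin 4 → Fin 4 → ℂ := fun i j =>
    (((if i = j then 1 else 0) / ‖x‖ ^ 2 - 2 * (x i * x j) / ‖x‖ ^ 4 : ℝ) : ℂ)
  have hpt : ∀ y : R4, 2 * ((V y : ℂ) * u y * logKernel x y) =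
      ((V y : ℂ) * u y * logRemainder x y + L * ((V y : ℂ) * u y)) +
        (∑ i, α i * ((V y : ℂ) * u y * (y i : ℝ)) +
          ∑ i, ∑ j, β i j * ((V y : ℂ) * u y * (y i * y j : ℝ))) := by
    intro y
    have h := congrArg (fun t : ℝ => (V y : ℂ) * u y * (t : ℂ)) (two_mul_logKernel_eq x y)
    simp only [Complex.ofReal_add, Complex.ofReal_sum, mul_add, Finset.mul_sum] at h
    have h' : 2 * ((V y : ℂ) * u y * logKernel x y) =
        (V y : ℂ) * u y * ((2 * logKernel x y : ℝ) : ℂ) := by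
      push_cast
      ring
    rw [h', h]
    congr 1
    · simp only [L]
      ring
    · congr 1
      · refine Finset.sum_congr rfl fun i _ => ?_
        simp only [α, Complex.ofReal_mul]
        ring
      · refine Finset.sum_congr rfl fun i _ => Finset.sum_congr rfl fun j _ => ?_
        rw [Complex.ofReal_mul]
        ring
  have hs1 : Integrable (fun y : R4 => ∑ i, α i * ((V y : ℂ) * u y * (y i : ℝ))) volume :=
    integrable_finsetSum _ fun i _ => (hi1 i).const_mul _
  have hs3 : ∀ i, Integrable (fun y : R4 =>
      ∑ j, β i j * ((V y : ℂ) * u y * (y i * y j : ℝ))) volume :=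
    fun i => integrable_finsetSum _ fun j _ => (hi2 i j).const_mul _
  have hs2 : Integrable (fun y : R4 =>
      ∑ i, ∑ j, β i j * ((V y : ℂ) * u y * (y i * y j : ℝ))) volume :=
    integrable_finsetSum _ fun i _ => hs3 i
  have hs4 : Integrable (fun y : R4 => (V y : ℂ) * u y * logRemainder x y +
      L * ((V y : ℂ) * u y)) volume := hR.add (hv.const_mul L)
  have hs5 : Integrable (fun y : R4 => ∑ i, α i * ((V y : ℂ) * u y * (y i : ℝ)) +
      ∑ i, ∑ j, β i j * ((V y : ℂ) * u y * (y i * y j : ℝ))) volume := hs1.add hs2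
  rw [← integral_const_mul]
  simp_rw [hpt]
  rw [integral_add hs4 hs5, integral_add hR (hv.const_mul L), integral_const_mul, h0, mul_zero,
    add_zero, integral_add hs1 hs2, integral_finsetSum _ fun i _ => (hi1 i).const_mul _,
    integral_finsetSum _ fun i _ => hs3 i]
  simp_rw [integral_finsetSum _ fun j _ => (hi2 _ j).const_mul _, integral_const_mul]
  rfl

end

/-- Writing `|x|⁻²` as `|x|²/|x|⁴` puts the trace part and the second-moment part over one
denominator, with matrix `(tr(m) I - 2m)/κ`. -/
theorem sum_mul_sum_eq_dotProduct_div (m : Fin 4 → Fin 4 → ℝ) (κ : ℝ) {x : R4} (hx : x ≠ 0) :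
    (∑ i, ∑ j, ((if i = j then 1 else 0) / ‖x‖ ^ 2 - 2 * (x i * x j) / ‖x‖ ^ 4) * m i j) / κ =
      ((Matrix.of fun i j => ((if i = j then ∑ k, m k k else 0) - 2 * m i j) / κ) *ᵥ x.ofLp ⬝ᵥ
        x.ofLp) / ‖x‖ ^ 4 := by
  have hr : ‖x‖ ≠ 0 := norm_ne_zero_iff.2 hx
  have h2 : ‖x‖ ^ 2 = ∑ i, x i ^ 2 := EuclideanSpace.real_norm_sq_eq x
  have h1 : ∑ i, ∑ j, ((if i = j then 1 else 0) / ‖x‖ ^ 2 - 2 * (x i * x j) / ‖x‖ ^ 4) * m i j =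
      (‖x‖ ^ 2 * ∑ k, m k k - 2 * ∑ i, ∑ j, x i * x j * m i j) / ‖x‖ ^ 4 := by
    simp only [Fin.sum_univ_four, Fin.reduceEq, if_true, if_false]
    field_simp
    ring
  have h3 : (Matrix.of fun i j => ((if i = j then ∑ k, m k k else 0) - 2 * m i j) / κ) *ᵥ x.ofLp ⬝ᵥ
      x.ofLp = (‖x‖ ^ 2 * ∑ k, m k k - 2 * ∑ i, ∑ j, x i * x j * m i j) / κ := by
    rw [h2]
    simp only [Matrix.mulVec, dotProduct, Matrix.of_apply, Fin.sum_univ_four, Fin.reduceEq, if_true,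
      if_false]
    ring
  rw [h1, h3]
  ring

theorem IsLogPotential.exists_isBigO {V : R4 → ℝ} {C : ℝ} (hV : IsLogPotential V C)
    {φ : Lp ℂ ∞ (volume : Measure R4)} (hφ : φ ∈ zeroResonanceSpace V)
    (him : ∀ᵐ x : R4, (φ x).im = 0) :
    ∃ (c₀ : ℝ) (a : R4) (A : Matrix (Fin 4) (Fin 4) ℝ), A.IsSymm ∧
      (fun x : R4 => φ x -
          ((-c₀ + inner ℝ a x / ‖x‖ ^ 2 +
            ((A *ᵥ x.ofLp) ⬝ᵥ x.ofLp) / ‖x‖ ^ 4 : ℝ) : ℂ))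
        =O[cocompact R4 ⊓ ae (volume : Measure R4)] fun x : R4 => (‖x‖ ^ 3)⁻¹ := by
  obtain ⟨u, M, hu, hM, hφu⟩ := exists_bounded_representative φ
  obtain ⟨h0, c, hc⟩ := hV.exists_representation hu hM (IsDistribSolution.congr hφu hφ)
  have hκ := integral_biharmonicBump_pos
  set κ := ∫ y, biharmonicBump 1 y
  let b : Fin 4 → ℂ := fun i => ∫ y, (V y : ℂ) * u y * (y i : ℝ)
  let m : Fin 4 → Fin 4 → ℂ := fun i j => ∫ y, (V y : ℂ) * u y * (y i * y j : ℝ)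
  have hm : ∀ i j, m i j = m j i := fun i j => by
    simp only [m]
    congr 1
    funext y
    rw [mul_comm (y i)]
  refine ⟨-(c.re / κ), WithLp.toLp 2 fun i => -2 * (b i).re / κ,
    Matrix.of fun i j => ((if i = j then ∑ k, (m k k).re else 0) - 2 * (m i j).re) / κ, ?_, ?_⟩
  · ext i j
    simp only [Matrix.transpose_apply, Matrix.of_apply, hm j i, eq_comm (a := j)]
  have hne : ∀ᶠ x : R4 in cocompact R4, x ≠ 0 :=
    (isCompact_singleton (x := (0 : R4))).compl_mem_cocompact
  have hboth : ∀ᶠ x : R4 in cocompact R4 ⊓ ae (volume : Measure R4), x ≠ 0 ∧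
      (φ x = u x ∧ (φ x).im = 0 ∧
        (κ : ℂ) * u x = c + 2 * ∫ y, (V y : ℂ) * u y * logKernel x y) :=
    (hne.filter_mono inf_le_left).and
      (Eventually.filter_mono inf_le_right (hφu.and (him.and hc)))
  refine IsBigO.of_bound (588 * M * C / κ) ?_
  filter_upwards [hboth] with x ⟨hx, hux, hxim, hrep⟩
  rw [hV.two_mul_integral_logKernel_eq hu hM h0 hx] at hrep
  have hE := (hV.integrable_mul_logRemainder hu hM hx).2
  set E := ∫ y, (V y : ℂ) * u y * logRemainder x y
  -- Kernel, coefficients and `κ` are real, so taking real parts keeps the expansion and makes its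
  -- coefficients real; for real-valued `φ` nothing is lost.
  have hre := congrArg Complex.re hrep
  simp only [Complex.add_re, Complex.re_sum, Complex.re_ofReal_mul] at hre
  have hφx : φ x = ((φ x).re : ℂ) := Complex.ext rfl (by simpa using hxim)
  have hmat := sum_mul_sum_eq_dotProduct_div (fun i j => (m i j).re) κ hx
  have hinner : inner ℝ (WithLp.toLp 2 fun i => -2 * (b i).re / κ : R4) x / ‖x‖ ^ 2 =
      (∑ i, -2 * x i / ‖x‖ ^ 2 * (b i).re) / κ := by
    rw [PiLp.inner_apply, Finset.sum_div, Finset.sum_div]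
    refine Finset.sum_congr rfl fun i _ => ?_
    simp only [RCLike.inner_apply, conj_trivial]
    ring
  have hu_re : (u x).re = (E.re + c.re + ∑ i, -2 * x i / ‖x‖ ^ 2 * (b i).re +
      ∑ i, ∑ j, ((if i = j then 1 else 0) / ‖x‖ ^ 2 - 2 * (x i * x j) / ‖x‖ ^ 4) *
        (m i j).re) / κ := by
    rw [eq_div_iff hκ.ne', mul_comm, hre]
    ring
  rw [hφx, ← Complex.ofReal_sub, Complex.norm_real, hux, hu_re, hinner, ← hmat]
  have hfin : ∀ p s : ℝ, (E.re + c.re + p + s) / κ - (- -(c.re / κ) + p / κ + s / κ) = E.re / κ := by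
    intro p s
    field_simp
    ring
  rw [hfin, norm_div, Real.norm_of_nonneg hκ.le, Real.norm_of_nonneg (by positivity : 0 ≤ (‖x‖ ^ 3)⁻¹),
    div_mul_eq_mul_div]
  exact div_le_div_of_nonneg_right ((Complex.abs_re_le_norm E).trans hE) hκ.le

theorem mainTheorem6 (V : R4 → ℝ) (q : ℝ≥0∞) (hq : 1 < q)
    (hV1 : MemLp (fun x : R4 =>
      japaneseBracket (Real.log ‖x‖) ^ 2 * japaneseBracket x ^ 3 * V x) 1 volume)
    (hVq : MemLp (fun x : R4 =>
      japaneseBracket (Real.log ‖x‖) ^ 2 * japaneseBracket x ^ 3 * V x) q volume) :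
    FiniteDimensional ℝ (zeroResonanceSpace V) ∧
    ∀ φ ∈ zeroResonanceSpace V, (∀ᵐ x : R4, (φ x).im = 0) →
      ∃ (c₀ : ℝ) (a : R4) (A : Matrix (Fin 4) (Fin 4) ℝ), A.IsSymm ∧
        (fun x : R4 => φ x -
            ((-c₀ + inner ℝ a x / ‖x‖ ^ 2 +
              ((A *ᵥ x.ofLp) ⬝ᵥ x.ofLp) / ‖x‖ ^ 4 : ℝ) : ℂ))
          =O[cocompact R4 ⊓ ae (volume : Measure R4)] fun x : R4 => (‖x‖ ^ 3)⁻¹ := by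
  obtain ⟨C, hV⟩ := exists_isLogPotential hq hV1 hVq
  have := hV.finiteDimensional
  -- Finite dimension over `ℂ` gives finite dimension over `ℝ`.
  exact ⟨FiniteDimensional.trans ℝ ℂ _, fun φ hφ him => hV.exists_isBigO hφ him⟩
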